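/- Let $N\ge 1$ and let $\Omega\subset\mathbb R^N$ be a bounded domain (nonempty, open, connected). Put $c_N=\pi^{-N/2}\Gamma(N/2)$ and $\rho_N=2\log 2+\psi(N/2)-\gamma$, where $\psi=\Gamma'/\Gamma$ and $\gamma=-\Gamma'(1)$. Let $\mathbb H(\Omega)$ be the space of all measurable $u:\mathbb R^N\to\mathbb R$ with $u=0$ on $\mathbb R^N\setminus\Omega$ and $$\iint_{|x-y|\le 1}\frac{(u(x)-u(y))^2}{|x-y|^N}\,dx\,dy<\infty,$$ where functions are identified if they agree almost everywhere, and for $u,w\in\mathbb H(\Omega)$ let $$\mathcal E_L(u,w)=\frac{c_N}{2}\iint_{|x-y|\le 1}\frac{(u(x)-u(y))(w(x)-w(y))}{|x-y|^N}\,dx\,dy-c_N\iint_{|x-y|\ge 1}\frac{u(x)w(y)}{|x-y|^N}\,dx\,dy+\rho_N\int_{\mathbb R^N}uw\,dx .$$ A function $u\in\mathbb H(\Omega)$ is a weak solution of $L_\Delta u=\lambda u$ in $\Omega$, $u=0$ in $\mathbb R^N\setminus\Omega$, if $\mathcal E_L(u,\varphi)=\lambda\int_\Omega u\varphi\,dx$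 for all $\varphi\in\mathbb H(\Omega)$; if moreover $u\not\equiv0$, then $u$ is called an eigenfunction with eigenvalue $\lambda$. Theorem. There are real eigenvalues $\lambda_1^L<\lambda_2^L\le\lambda_3^L\le\cdots$ and corresponding eigenfunctions $\xi_k\in\mathbb H(\Omega)$, $k=1,2,3,\dots$, such that: (i) $\lambda_k^L=\min\{\mathcal E_L(u,u): u\in\mathbb H_k(\Omega),\ \|u\|_{L^2(\Omega)}=1\}$ for every $k\ge 1$, where $\mathbb H_1(\Omega)=\mathbb H(\Omega)$ and $\mathbb H_k(\Omega)=\{u\in\mathbb H(\Omega):\int_\Omega u\xi_i\,dx=0 \text{ for } i=1,\dots,k-1\}$ for $k>1$. (ii) $\{\xi_k: k\ge 1\}$ is an orthonormal basis of $L^2(\Omega)$. (iii) $\xi_1$ is strictly positive in $\Omega$, that is, for a suitable representative, $\xi_1(x)>0$ for every $x\in\Omega$ and $\inf_K\xi_1>0$ for every nonempty compact $K\subset\Omega$. Moreover, $\lambda_1^L$ is simple: if $u\in\mathbb H(\Omega)$ is a weak solution of $L_\Delta u=\lambda_1^L u$ in $\Omega$, $u=0$ in $\mathbb R^N\setminus\Omega$,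 then $u=t\,\xi_1$ for some $t\in\mathbb R$. (iv) $\lim_{k\to\infty}\lambda_k^L=+\infty$. -/

import Mathlib

open MeasureTheory Filter
open scoped ENNReal Topology

namespace LogLaplacian

/-- Euclidean space `ℝ^N`. -/
abbrev Space (N : ℕ) : Type := EuclideanSpace ℝ (Fin N)

/-- The constant `c_N = π^{-N/2} Γ(N/2)`. -/
noncomputable def cConst (N : ℕ) : ℝ :=
  Real.pi ^ (-(N : ℝ) / 2) * Real.Gamma ((N : ℝ) / 2)

/-- The constant `ρ_N = 2 log 2 + ψ(N/2) - γ`, where `ψ = Γ'/Γ` is the digamma function and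
`γ` is the Euler-Mascheroni constant. -/
noncomputable def rhoConst (N : ℕ) : ℝ :=
  2 * Real.log 2 + logDeriv Real.Gamma ((N : ℝ) / 2) - Real.eulerMascheroniConstant

/-- The pairs `(x, y)` with `|x - y| ≤ 1`. -/
def nearPairs (N : ℕ) : Set (Space N × Space N) := {p | ‖p.1 - p.2‖ ≤ 1}

/-- The pairs `(x, y)` with `|x - y| ≥ 1`. -/
def farPairs (N : ℕ) : Set (Space N × Space N) := {p | 1 ≤ ‖p.1 - p.2‖}

/-- The space `ℍ(Ω)`: all (Lebesgue) measurable functions `u : ℝ^N → ℝ` that vanish outside `Ω`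
and satisfy `∬_{|x-y| ≤ 1} (u(x) - u(y))² / |x - y|^N dx dy < ∞`. -/
def hSpace {N : ℕ} (Ω : Set (Space N)) : Set (Space N → ℝ) :=
  {u | AEMeasurable u volume ∧ (∀ x, x ∉ Ω → u x = 0) ∧
    ∫⁻ p in nearPairs N, ENNReal.ofReal ((u p.1 - u p.2) ^ 2 / ‖p.1 - p.2‖ ^ N)
      ∂(volume.prod volume) < ∞}

/-- The inner product
`ℰ(u, w) = (c_N / 2) ∬_{|x-y| ≤ 1} (u(x) - u(y)) (w(x) - w(y)) / |x - y|^N dx dy`. -/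
noncomputable def energy {N : ℕ} (u w : Space N → ℝ) : ℝ :=
  cConst N / 2 * ∫ p in nearPairs N,
    (u p.1 - u p.2) * (w p.1 - w p.2) / ‖p.1 - p.2‖ ^ N ∂(volume.prod volume)

/-- The bilinear form of the logarithmic Laplacian,
`ℰ_L(u, w) = ℰ(u, w) - c_N ∬_{|x-y| ≥ 1} u(x) w(y) / |x - y|^N dx dy + ρ_N ∫ u w dx`. -/
noncomputable def logForm {N : ℕ} (u w : Space N → ℝ) : ℝ :=
  energy u w
    - cConst N * ∫ p in farPairs N, u p.1 * w p.2 / ‖p.1 - p.2‖ ^ N ∂(volume.prod volume)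
    + rhoConst N * ∫ x, u x * w x

/-- `u ∈ ℍ(Ω)` solves `L_Δ u = lam u` in `Ω`, `u = 0` in `ℝ^N \ Ω`, in the weak sense. -/
def IsWeakSolution {N : ℕ} (Ω : Set (Space N)) (lam : ℝ) (u : Space N → ℝ) : Prop :=
  u ∈ hSpace Ω ∧ ∀ φ ∈ hSpace Ω, logForm u φ = lam * ∫ x in Ω, u x * φ x

/-- `u` is an eigenfunction of the weak Dirichlet problem for `L_Δ` in `Ω`, with eigenvalue `lam`:
a weak solution that does not vanish almost everywhere. -/
def IsEigenfunction {N : ℕ} (Ω : Set (Space N)) (lam : ℝ) (u : Space N → ℝ) : Prop :=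
  IsWeakSolution Ω lam u ∧ ¬ (u =ᵐ[volume] 0)

/-- The functions in `ℍ(Ω)` that are `L²(Ω)`-orthogonal to `ξ i` for all `i < k`
(for `k = 0` this is `ℍ(Ω)` itself). -/
def hOrth {N : ℕ} (Ω : Set (Space N)) (ξ : ℕ → Space N → ℝ) (k : ℕ) : Set (Space N → ℝ) :=
  {u | u ∈ hSpace Ω ∧ ∀ i < k, ∫ x in Ω, u x * ξ i x = 0}

end LogLaplacian

/-!
The kernel `|z|^{-N}` fails to be integrable at the origin, but only just, and everything
rests on splitting the form at a small distance `δ` (`logForm_split`):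
`ℰ_L(u, w) = E_δ(u, w) + m_δ ∫ u w - c_N ∬ G_δ(x - y) u(x) w(y) dx dy`,
where `E_δ ≥ 0` is the energy of the pairs with `|x - y| ≤ δ`, the kernel `G_δ` is bounded, and
`m_δ`, a multiple of `log (1/δ)` up to a constant, tends to infinity as `δ → 0`
(`tendsto_massCoeff`).

*Spectrum.* The far term has a bounded kernel, so the form is bounded below on `L²(Ω)`. The
splitting for small `δ` shows that `ℍ(Ω) → L²(Ω)` is compact: along a weakly convergent
sequence the convolution term converges by dominated convergence, while the `m_δ` term controls the `L²` distance
(`formCompact_logBilin`). With Fatou's lemma, minimisers exist on every closed constraint, and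
choosing them successively gives the eigenvalues, the eigenfunctions and the minimum
characterization; this part is a statement about abstract forms (`exists_formEigenbasis`).
Completeness and the divergence of the eigenvalues come from compactness and from the density of
smooth functions. That `ℍ(Ω) ⊆ L²` at all is a telescoping argument (`memLp_two_of_mem_hSpace`).

*Positivity.* Passing to `|u|` does not increase the form, so the absolute value of a first
eigenfunction is again one. A nonnegative solution `v ≢ 0` is compared near a point `x₀` with a
small Lipschitz bump `t f`, the test function being `(t f - v)⁺`. If `δ` is so small that `m_δ`
exceeds the eigenvalue and `v` has mass at distance more than `2δ` from `x₀`, the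
convolution term supplies a positive lower bound, and `v ≥ t f` follows
(`IsWeakSolution.exists_ball_le`). Let `e > 0` be a first eigenfunction and `z` a solution for the
same eigenvalue that is orthogonal to `e`. Then `|z| + z` and `|z| - z` are nonnegative solutions,
each zero or positive throughout `Ω`; positivity of either would give `z` a strict sign and
contradict orthogonality, so `z = 0` (`ae_eq_zero_of_orthogonal`) and the eigenvalue is simple.
-/

namespace LogLaplacian

/-! ### Minimax eigenvalues of forms with compact sublevel sets -/

section Abstract

open scoped RealInnerProductSpace

variable {V H : Type*} [AddCommGroup V] [Module ℝ V] [NormedAddCommGroup H]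
  [InnerProductSpace ℝ H]

/-- The compactness property of a quadratic form `a` relative to `L : V → H`: a normalised sequence
along which the form converges has a subsequence converging in `H` to the image of a vector
at which the form does not exceed the limit. It combines the compactness of the embedding of the
form domain with the lower semicontinuity of the form. -/
def FormCompact (L : V →ₗ[ℝ] H) (a : V →ₗ[ℝ] V →ₗ[ℝ] ℝ) : Prop :=
  ∀ (u : ℕ → V) (c : ℝ), (∀ n, ‖L (u n)‖ = 1) → Tendsto (fun n => a (u n) (u n)) atTop (𝓝 c) →
    ∃ (φ : ℕ → ℕ) (v : V), StrictMono φ ∧ Tendsto (fun n => L (u (φ n))) atTop (𝓝 (L v)) ∧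
      a v v ≤ c

/-- `e` minimises the form on the unit sphere of the orthogonal complement of `S`. -/
def IsFormMinimizer (L : V →ₗ[ℝ] H) (a : V →ₗ[ℝ] V →ₗ[ℝ] ℝ) (S : Set V) (e : V) : Prop :=
  ‖L e‖ = 1 ∧ (∀ s ∈ S, ⟪L e, L s⟫ = 0) ∧
    ∀ v, (∀ s ∈ S, ⟪L v, L s⟫ = 0) → a e e * ‖L v‖ ^ 2 ≤ a v v

lemma exists_orthogonal_ne_zero {L : V →ₗ[ℝ] H} (hdense : DenseRange L)
    (hinf : ¬ FiniteDimensional ℝ H) {S : Set V} (hS : S.Finite) :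
    ∃ v, L v ≠ 0 ∧ ∀ s ∈ S, ⟪L v, L s⟫ = 0 := by
  by_contra! hcon
  apply hinf
  set W : Submodule ℝ H := Submodule.span ℝ (L '' S) with hW
  have : FiniteDimensional ℝ W := FiniteDimensional.span_of_finite ℝ (hS.image L)
  have hWr : ∀ w ∈ W, ∃ v, L v = w := by
    intro w hw
    have : W ≤ LinearMap.range L := Submodule.span_le.2 (by rintro _ ⟨s, -, rfl⟩; exact ⟨s, rfl⟩)
    exact this hw
  have hrange : Set.range L ⊆ (W : Set H) := by
    rintro _ ⟨v, rfl⟩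
    obtain ⟨v', hv'⟩ := hWr (W.starProjection (L v)) (by simp)
    have h0 : L (v - v') = 0 := by
      by_contra hne
      obtain ⟨s, hs, hne'⟩ := hcon (v - v') hne
      apply hne'
      rw [map_sub, hv', real_inner_comm]
      have := W.sub_starProjection_mem_orthogonal (L v)
      exact this _ (Submodule.subset_span ⟨s, hs, rfl⟩)
    rw [map_sub, sub_eq_zero] at h0
    rw [h0, hv']
    simp
  have hclosed : IsClosed (W : Set H) := W.closed_of_finiteDimensional
  have htop : W = ⊤ := by
    rw [eq_top_iff]
    intro x _
    exact hclosed.closure_subset_iff.2 hrange (hdense x)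
  rw [htop] at this
  exact Module.Finite.equiv (Submodule.topEquiv (R := ℝ) (M := H))

lemma quadratic_smul (a : V →ₗ[ℝ] V →ₗ[ℝ] ℝ) (t : ℝ) (v : V) :
    a (t • v) (t • v) = t ^ 2 * a v v := by
  simp [pow_two, mul_assoc]

lemma exists_formMinimizer {L : V →ₗ[ℝ] H} {a : V →ₗ[ℝ] V →ₗ[ℝ] ℝ} {C : ℝ}
    (hbelow : ∀ u, -C * ‖L u‖ ^ 2 ≤ a u u) (hcpt : FormCompact L a) (hdense : DenseRange L)
    (hinf : ¬ FiniteDimensional ℝ H) {S : Set V} (hS : S.Finite) :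
    ∃ e, IsFormMinimizer L a S e := by
  obtain ⟨v₀, hv₀, hv₀S⟩ := exists_orthogonal_ne_zero hdense hinf hS
  set A : Set ℝ := {t | ∃ v, ‖L v‖ = 1 ∧ (∀ s ∈ S, ⟪L v, L s⟫ = 0) ∧ a v v = t} with hA
  have hnorm : ∀ v, L v ≠ 0 → (∀ s ∈ S, ⟪L v, L s⟫ = 0) → a v v / ‖L v‖ ^ 2 ∈ A := by
    intro v hv hvS
    refine ⟨‖L v‖⁻¹ • v, ?_, ?_, ?_⟩
    · rw [map_smul, norm_smul, norm_inv, norm_norm, inv_mul_cancel₀ (norm_ne_zero_iff.2 hv)]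
    · intro s hs
      rw [map_smul, real_inner_smul_left, hvS s hs, mul_zero]
    · rw [quadratic_smul]
      field_simp
  have hne : A.Nonempty := ⟨_, hnorm v₀ hv₀ hv₀S⟩
  have hbdd : BddBelow A := by
    refine ⟨-C, ?_⟩
    rintro _ ⟨v, hv, -, rfl⟩
    simpa [hv] using hbelow v
  obtain ⟨t, -, ht, htA⟩ := exists_seq_tendsto_sInf hne hbdd
  choose u hu1 huS hut using htA
  obtain ⟨φ, e, hφ, he, hae⟩ := hcpt u (sInf A) hu1 (by simpa only [hut] using ht)
  have he1 : ‖L e‖ = 1 := by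
    have := he.norm
    simp only [hu1] at this
    exact (tendsto_nhds_unique this tendsto_const_nhds)
  have heS : ∀ s ∈ S, ⟪L e, L s⟫ = 0 := by
    intro s hs
    have := he.inner (𝕜 := ℝ) (tendsto_const_nhds (x := L s))
    simp only [huS _ s hs] at this
    exact (tendsto_nhds_unique this tendsto_const_nhds)
  refine ⟨e, he1, heS, fun v hv => ?_⟩
  by_cases h0 : L v = 0
  · have hz := hbelow v
    simp only [h0, norm_zero] at hz ⊢
    linarith
  · have := csInf_le hbdd (hnorm v h0 hv)
    rw [← le_div_iff₀ (by positivity)]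
    exact hae.trans this

/-- The Euler-Lagrange equation of a constrained minimiser, tested against admissible vectors. -/
lemma IsFormMinimizer.form_eq {L : V →ₗ[ℝ] H} {a : V →ₗ[ℝ] V →ₗ[ℝ] ℝ}
    (hsymm : ∀ u v, a u v = a v u) {S : Set V} {e v : V} {μ : ℝ}
    (hmin : ∀ v, (∀ s ∈ S, ⟪L v, L s⟫ = 0) → μ * ‖L v‖ ^ 2 ≤ a v v)
    (heS : ∀ s ∈ S, ⟪L e, L s⟫ = 0) (he : a e e = μ * ‖L e‖ ^ 2)
    (hv : ∀ s ∈ S, ⟪L v, L s⟫ = 0) : a e v = μ * ⟪L e, L v⟫ := by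
  have key : ∀ t : ℝ, 0 ≤ (a v v - μ * ‖L v‖ ^ 2) * (t * t) +
      (2 * (a e v - μ * ⟪L e, L v⟫)) * t + 0 := by
    intro t
    have h1 := hmin (e + t • v) (fun s hs => by
      rw [map_add, map_smul, inner_add_left, real_inner_smul_left, heS s hs, hv s hs]; ring)
    rw [map_add, map_smul, norm_add_sq_real, norm_smul, real_inner_smul_right] at h1
    simp only [map_add, map_smul, LinearMap.add_apply, LinearMap.smul_apply, smul_eq_mul,
      Real.norm_eq_abs, mul_pow, sq_abs] at h1
    rw [hsymm v e] at h1
    nlinarith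
  have := discrim_le_zero key
  rw [discrim] at this
  have h2 : (2 * (a e v - μ * ⟪L e, L v⟫)) ^ 2 ≤ 0 := by linarith
  have h3 := pow_eq_zero_iff (two_ne_zero) |>.1 (le_antisymm h2 (sq_nonneg _))
  linarith

/-- The sequence in which every term is chosen as a function of the set of its predecessors. -/
noncomputable def greedySeq (next : Set V → V) (k : ℕ) : V :=
  next (Set.range fun i : Fin k => greedySeq next i)
termination_by k
decreasing_by exact i.2

/-- Minimising successively over the orthogonal complements of the earlier minimisers, from a
prescribed first minimiser `e₀` on, gives an orthonormal basis of eigenvectors with eigenvalues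
tending to infinity. -/
lemma exists_formEigenbasis {L : V →ₗ[ℝ] H} {a : V →ₗ[ℝ] V →ₗ[ℝ] ℝ} {C : ℝ}
    (hsymm : ∀ u v, a u v = a v u) (hbelow : ∀ u, -C * ‖L u‖ ^ 2 ≤ a u u)
    (hcpt : FormCompact L a) (hdense : DenseRange L) (hinf : ¬ FiniteDimensional ℝ H)
    {e₀ : V} (he₀ : IsFormMinimizer L a ∅ e₀) :
    ∃ (lam : ℕ → ℝ) (ξ : ℕ → V), ξ 0 = e₀ ∧ Monotone lam ∧ Orthonormal ℝ (fun k => L (ξ k)) ∧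
      (∀ k, a (ξ k) (ξ k) = lam k) ∧
      (∀ k v, (∀ i < k, ⟪L v, L (ξ i)⟫ = 0) → lam k * ‖L v‖ ^ 2 ≤ a v v) ∧
      (∀ k v, a (ξ k) v = lam k * ⟪L (ξ k), L v⟫) ∧
      Tendsto lam atTop atTop ∧
      (⊤ ≤ (Submodule.span ℝ (Set.range fun k => L (ξ k))).topologicalClosure) := by
  classical
  have hnext : ∀ S : Set V, S.Finite → ∃ e, IsFormMinimizer L a S e :=
    fun S hS => exists_formMinimizer hbelow hcpt hdense hinf hS
  let next : Set V → V := fun S =>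
    if S = ∅ then e₀ else if hS : S.Finite then (hnext S hS).choose else e₀
  have hnext' : ∀ S : Set V, S.Finite → IsFormMinimizer L a S (next S) := by
    intro S hS
    by_cases h : S = ∅
    · simpa [next, h] using he₀
    · simpa [next, h, hS] using (hnext S hS).choose_spec
  set ξ : ℕ → V := greedySeq next with hξ
  have hξmin : ∀ k, IsFormMinimizer L a (Set.range fun i : Fin k => ξ i) (ξ k) := by
    intro k
    have := hnext' (Set.range fun i : Fin k => ξ i) (Set.finite_range _)
    rw [hξ, greedySeq]
    exact this
  have hξ0 : ξ 0 = e₀ := by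
    rw [hξ, greedySeq]
    simp [next]
  have hrange : ∀ k v, (∀ i < k, ⟪L v, L (ξ i)⟫ = 0) →
      ∀ s ∈ Set.range (fun i : Fin k => ξ i), ⟪L v, L s⟫ = 0 := by
    rintro k v h _ ⟨i, rfl⟩
    exact h i i.2
  set lam : ℕ → ℝ := fun k => a (ξ k) (ξ k) with hlam
  have hnorm : ∀ k, ‖L (ξ k)‖ = 1 := fun k => (hξmin k).1
  have horth : ∀ k, ∀ i < k, ⟪L (ξ k), L (ξ i)⟫ = 0 := fun k i hi =>
    (hξmin k).2.1 _ ⟨⟨i, hi⟩, rfl⟩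
  have horth' : ∀ i j, i ≠ j → ⟪L (ξ i), L (ξ j)⟫ = 0 := by
    intro i j hij
    rcases lt_or_gt_of_ne hij with h | h
    · rw [real_inner_comm]; exact horth j i h
    · exact horth i j h
  have hON : Orthonormal ℝ (fun k => L (ξ k)) := ⟨hnorm, fun i j hij => horth' i j hij⟩
  have hmin : ∀ k v, (∀ i < k, ⟪L v, L (ξ i)⟫ = 0) → lam k * ‖L v‖ ^ 2 ≤ a v v :=
    fun k v hv => (hξmin k).2.2 v (hrange k v hv)
  have hmono : Monotone lam := by
    intro j k hjk
    have := hmin j (ξ k) (fun i hi => horth k i (hi.trans_le hjk))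
    simpa [hnorm] using this
  -- `rem k v` is the component of `v` orthogonal to the first `k` eigenvectors
  let rem : ℕ → V → V := fun k v => v - ∑ i ∈ Finset.range k, ⟪L (ξ i), L v⟫ • ξ i
  have hrem : ∀ k v, ∀ i < k, ⟪L (rem k v), L (ξ i)⟫ = 0 := by
    intro k v i hi
    have : L (rem k v) = L v - ∑ j ∈ Finset.range k, ⟪L (ξ j), L v⟫ • L (ξ j) := by
      simp [rem, map_sum]
    rw [this, inner_sub_left, sum_inner, Finset.sum_eq_single i]
    · rw [real_inner_smul_left, real_inner_self_eq_norm_sq, hnorm, real_inner_comm]; ring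
    · intro j _ hj
      rw [real_inner_smul_left, horth' j i hj, mul_zero]
    · intro h
      exact absurd (Finset.mem_range.2 hi) h
  have heq : ∀ k v, a (ξ k) v = lam k * ⟪L (ξ k), L v⟫ := by
    intro k
    induction k using Nat.strong_induction_on with
    | _ k ih =>
      intro v
      have h1 := IsFormMinimizer.form_eq hsymm (hξmin k).2.2 (hξmin k).2.1
        (by rw [hnorm]; ring) (hrange k (rem k v) (hrem k v))
      have h2 : ∀ i < k, a (ξ k) (ξ i) = 0 := by
        intro i hi
        rw [hsymm, ih i hi, real_inner_comm, horth k i hi, mul_zero]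
      have h3 : a (ξ k) (rem k v) = a (ξ k) v := by
        simp only [rem, map_sub, map_sum, map_smul, smul_eq_mul]
        rw [Finset.sum_eq_zero, sub_zero]
        intro i hi
        rw [h2 i (Finset.mem_range.1 hi), mul_zero]
      have h4 : ⟪L (ξ k), L (rem k v)⟫ = ⟪L (ξ k), L v⟫ := by
        simp only [rem, map_sub, map_sum, map_smul, inner_sub_right, inner_sum,
          real_inner_smul_right]
        rw [Finset.sum_eq_zero, sub_zero]
        intro i hi
        rw [horth k i (Finset.mem_range.1 hi), mul_zero]
      rw [← h3, h1, h4]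
  have hlim : Tendsto lam atTop atTop := by
    rcases tendsto_atTop_of_monotone hmono with h | ⟨c, hc⟩
    · exact h
    exfalso
    -- an orthonormal sequence has no convergent subsequence
    obtain ⟨φ, v, hφ, hv, -⟩ := hcpt ξ c hnorm hc
    have h1 : Tendsto (fun n => ⟪L (ξ (φ n)), L (ξ (φ (n + 1)))⟫) atTop (𝓝 ⟪L v, L v⟫) :=
      hv.inner (𝕜 := ℝ) (hv.comp (tendsto_add_atTop_nat 1))
    have h2 : ∀ n, ⟪L (ξ (φ n)), L (ξ (φ (n + 1)))⟫ = 0 := fun n =>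
      horth' _ _ (hφ (Nat.lt_succ_self n)).ne
    simp only [h2] at h1
    have h3 := tendsto_nhds_unique h1 tendsto_const_nhds
    have h4 := hv.norm
    simp only [hnorm] at h4
    have h5 := tendsto_nhds_unique h4 tendsto_const_nhds
    rw [real_inner_self_eq_norm_sq, h5] at h3
    norm_num at h3
  refine ⟨lam, ξ, hξ0, hmono, hON, fun _ => rfl, hmin, heq, hlim, ?_⟩
  set W := Submodule.span ℝ (Set.range fun k => L (ξ k)) with hW
  -- the remainder of every `v` tends to `0`, so the image of `V` lies in the closed span
  have hmem : ∀ v, L v ∈ W.topologicalClosure := by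
    intro v
    have hbound : ∀ k, lam k * ‖L (rem k v)‖ ^ 2 ≤ a v v + |C| * ‖L v‖ ^ 2 +
        |lam 0| * ‖L v‖ ^ 2 := by
      intro k
      have h1 := hmin k (rem k v) (hrem k v)
      have h2 : a (rem k v) (rem k v) =
          a v v - ∑ i ∈ Finset.range k, lam i * ⟪L (ξ i), L v⟫ ^ 2 := by
        have h3 : ∀ i < k, a (ξ i) (rem k v) = 0 := by
          intro i hi
          rw [heq, real_inner_comm, hrem k v i hi, mul_zero]
        have h4 : a (rem k v) (rem k v) = a v (rem k v) := by
          conv_lhs =>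
            rw [show a (rem k v) = a v - ∑ i ∈ Finset.range k, ⟪L (ξ i), L v⟫ • a (ξ i) by
              simp [rem, map_sum]]
          simp only [LinearMap.sub_apply, LinearMap.sum_apply, LinearMap.smul_apply, smul_eq_mul]
          rw [Finset.sum_eq_zero, sub_zero]
          intro i hi
          rw [h3 i (Finset.mem_range.1 hi), mul_zero]
        rw [h4]
        simp only [rem, map_sub, map_sum, map_smul, smul_eq_mul]
        congr 1
        refine Finset.sum_congr rfl fun i _ => ?_
        rw [hsymm v, heq]; ring
      have hbessel : ∑ i ∈ Finset.range k, ⟪L (ξ i), L v⟫ ^ 2 ≤ ‖L v‖ ^ 2 := by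
        have := hON.sum_inner_products_le (x := L v) (s := Finset.range k)
        simpa [Real.norm_eq_abs, sq_abs] using this
      have h5 : -(|lam 0| * ‖L v‖ ^ 2) ≤
          ∑ i ∈ Finset.range k, lam i * ⟪L (ξ i), L v⟫ ^ 2 := by
        calc -(|lam 0| * ‖L v‖ ^ 2) ≤
              -(|lam 0| * ∑ i ∈ Finset.range k, ⟪L (ξ i), L v⟫ ^ 2) := by gcongr
          _ = ∑ i ∈ Finset.range k, -|lam 0| * ⟪L (ξ i), L v⟫ ^ 2 := by
              rw [Finset.mul_sum, ← Finset.sum_neg_distrib]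
              simp only [neg_mul]
          _ ≤ _ := by
              gcongr with i hi
              exact (neg_abs_le _).trans (hmono (Nat.zero_le i))
      have : 0 ≤ |C| * ‖L v‖ ^ 2 := by positivity
      linarith
    set B := a v v + |C| * ‖L v‖ ^ 2 + |lam 0| * ‖L v‖ ^ 2
    have hto : Tendsto (fun k => ‖L (rem k v)‖ ^ 2) atTop (𝓝 0) := by
      have hB : Tendsto (fun k => B / lam k) atTop (𝓝 0) := hlim.const_div_atTop B
      refine tendsto_of_tendsto_of_tendsto_of_le_of_le' tendsto_const_nhds hB
        (Eventually.of_forall fun k => by positivity) ?_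
      filter_upwards [hlim.eventually_gt_atTop 0] with k hk
      rw [le_div_iff₀ hk]
      linarith [hbound k]
    have hto' : Tendsto (fun k => ‖L (rem k v)‖) atTop (𝓝 0) := by
      have := hto.sqrt
      simpa using this
    have hto2 : Tendsto (fun k => L v - L (rem k v)) atTop (𝓝 (L v)) := by
      simpa using tendsto_const_nhds.sub (tendsto_zero_iff_norm_tendsto_zero.2 hto')
    refine mem_closure_of_tendsto hto2 (Eventually.of_forall fun k => ?_)
    have : L v - L (rem k v) = ∑ i ∈ Finset.range k, ⟪L (ξ i), L v⟫ • L (ξ i) := by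
      simp [rem, map_sum]
    rw [this]
    exact W.sum_mem fun i _ => W.smul_mem _ (Submodule.subset_span ⟨i, rfl⟩)
  intro x _
  have hcl : IsClosed (W.topologicalClosure : Set H) := W.isClosed_topologicalClosure
  exact hcl.closure_subset_iff.2 (by rintro _ ⟨v, rfl⟩; exact hmem v) (hdense x)

end Abstract

/-! ### Truncations of the kernel -/

variable {N : ℕ}

/-- The kernel `|z|^{-N}`, cut off to those `z` with `|z| ∈ I`. -/
noncomputable def radKer (N : ℕ) (I : Set ℝ) (z : Space N) : ℝ :=
  I.indicator (fun r => (r ^ N)⁻¹) ‖z‖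

lemma radKer_neg (I : Set ℝ) (z : Space N) : radKer N I (-z) = radKer N I z := by
  simp [radKer]

lemma radKer_nonneg (I : Set ℝ) (z : Space N) : 0 ≤ radKer N I z := by
  exact Set.indicator_apply_nonneg fun _ => by positivity

lemma radKer_of_mem {I : Set ℝ} {z : Space N} (h : ‖z‖ ∈ I) : radKer N I z = (‖z‖ ^ N)⁻¹ := by
  rw [radKer, Set.indicator_of_mem h]

lemma radKer_of_notMem {I : Set ℝ} {z : Space N} (h : ‖z‖ ∉ I) : radKer N I z = 0 := by
  rw [radKer, Set.indicator_of_notMem h]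

lemma measurable_radKer {I : Set ℝ} (hI : MeasurableSet I) : Measurable (radKer N I) :=
  (Measurable.indicator (by fun_prop) hI).comp measurable_norm

lemma radKer_le {I : Set ℝ} {δ : ℝ} (hδ : 0 < δ) (hI : I ⊆ Set.Ici δ) (z : Space N) :
    radKer N I z ≤ (δ ^ N)⁻¹ := by
  by_cases h : ‖z‖ ∈ I
  · rw [radKer_of_mem h]
    have : δ ≤ ‖z‖ := hI h
    gcongr
  · rw [radKer_of_notMem h]
    positivity

lemma radKer_Iic_eq_add {δ : ℝ} (hδ : δ ≤ 1) (z : Space N) :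
    radKer N (Set.Iic 1) z = radKer N (Set.Iic δ) z + radKer N (Set.Ioc δ 1) z := by
  by_cases h1 : ‖z‖ ≤ δ
  · rw [radKer_of_mem (I := Set.Iic 1) (h1.trans hδ), radKer_of_mem (I := Set.Iic δ) h1,
      radKer_of_notMem (fun h => absurd h.1 (not_lt.2 h1)), add_zero]
  · rw [radKer_of_notMem (I := Set.Iic δ) h1, zero_add]
    by_cases h2 : ‖z‖ ≤ 1
    · rw [radKer_of_mem (I := Set.Iic 1) h2, radKer_of_mem (I := Set.Ioc δ 1) ⟨not_le.1 h1, h2⟩]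
    · rw [radKer_of_notMem (I := Set.Iic 1) h2, radKer_of_notMem (fun h => h2 h.2)]

lemma integrable_radKer_Ioc {δ : ℝ} (hδ : 0 < δ) :
    Integrable (radKer N (Set.Ioc δ 1)) := by
  have hbd : ∀ z : Space N, ‖radKer N (Set.Ioc δ 1) z‖ ≤
      (Metric.closedBall (0 : Space N) 1).indicator (fun _ => (δ ^ N)⁻¹) z := by
    intro z
    rw [Real.norm_of_nonneg (radKer_nonneg _ _)]
    by_cases h : ‖z‖ ≤ 1
    · rw [Set.indicator_of_mem (by simpa using h)]
      exact radKer_le hδ (fun r hr => hr.1.le) z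
    · rw [radKer_of_notMem fun hh => h hh.2]
      exact Set.indicator_nonneg (fun _ _ => by positivity) _
  refine Integrable.mono' ?_ (measurable_radKer measurableSet_Ioc).aestronglyMeasurable
    (Eventually.of_forall hbd)
  exact (integrable_indicator_iff Metric.isClosed_closedBall.measurableSet).2
    (integrableOn_const (hs := (Metric.isBounded_closedBall.measure_lt_top).ne))

/-- The mass of the shell `δ < |z| ≤ 1` is a positive multiple of `log (1/δ)`: the kernel barely
fails to be integrable at the origin. -/
lemma integral_radKer_Ioc (hN : 1 ≤ N) {δ : ℝ} (hδ : 0 < δ) (hδ1 : δ ≤ 1) :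
    ∫ z, radKer N (Set.Ioc δ 1) z =
      N * volume.real (Metric.ball (0 : Space N) 1) * Real.log (1 / δ) := by
  have : NeZero N := ⟨by omega⟩
  have : Nontrivial (Space N) := inferInstance
  unfold radKer
  rw [integral_fun_norm_addHaar volume (fun r => (Set.Ioc δ 1).indicator (fun r => (r ^ N)⁻¹) r)]
  have h1 : ∫ y in Set.Ioi (0 : ℝ), y ^ (Module.finrank ℝ (Space N) - 1) •
      (Set.Ioc δ 1).indicator (fun r => (r ^ N)⁻¹) y = Real.log (1 / δ) := by
    have h2 : ∀ y ∈ Set.Ioi (0 : ℝ), y ^ (Module.finrank ℝ (Space N) - 1) •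
        (Set.Ioc δ 1).indicator (fun r => (r ^ N)⁻¹) y =
        (Set.Ioc δ 1).indicator (fun r => 1 / r) y := by
      intro y hy
      have hy' : y ≠ 0 := ne_of_gt hy
      by_cases h : y ∈ Set.Ioc δ 1
      · rw [Set.indicator_of_mem h, Set.indicator_of_mem h, finrank_euclideanSpace,
          Fintype.card_fin, smul_eq_mul]
        obtain ⟨n, rfl⟩ : ∃ n, N = n + 1 := ⟨N - 1, by omega⟩
        simp only [Nat.add_sub_cancel]
        field_simp
        ring
      · rw [Set.indicator_of_notMem h, Set.indicator_of_notMem h, smul_zero]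
    rw [setIntegral_congr_fun measurableSet_Ioi h2,
      setIntegral_indicator measurableSet_Ioc,
      Set.inter_eq_self_of_subset_right
        (show Set.Ioc δ 1 ⊆ Set.Ioi 0 from fun y hy => hδ.trans hy.1),
      ← intervalIntegral.integral_of_le hδ1, integral_one_div_of_pos hδ one_pos]
  rw [h1, finrank_euclideanSpace, Fintype.card_fin]
  simp [mul_assoc]

lemma tendsto_integral_radKer_Ioc (hN : 1 ≤ N) :
    Tendsto (fun δ : ℝ => ∫ z, radKer N (Set.Ioc δ 1) z) (𝓝[>] 0) atTop := by
  have : NeZero N := ⟨by omega⟩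
  have h1 : Tendsto (fun δ : ℝ => N * volume.real (Metric.ball (0 : Space N) 1) *
      Real.log (1 / δ)) (𝓝[>] 0) atTop := by
    have hpos : 0 < (N : ℝ) * volume.real (Metric.ball (0 : Space N) 1) := by
      have h2 : 0 < volume.real (Metric.ball (0 : Space N) 1) :=
        ENNReal.toReal_pos (Metric.measure_ball_pos _ _ one_pos).ne'
          Metric.isBounded_ball.measure_lt_top.ne
      positivity
    refine Tendsto.const_mul_atTop hpos (Real.tendsto_log_atTop.comp ?_)
    exact tendsto_inv_nhdsGT_zero.congr fun x => (one_div x).symm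
  refine h1.congr' ?_
  have h01 : Set.Ioo (0 : ℝ) 1 ∈ 𝓝[>] (0 : ℝ) := Ioo_mem_nhdsGT one_pos
  filter_upwards [h01] with δ hδ
  rw [integral_radKer_Ioc hN hδ.1 hδ.2.le]

lemma integrable_norm_mul_radKer (hN : 1 ≤ N) :
    Integrable (fun z : Space N => ‖z‖ * radKer N (Set.Iic 1) z) := by
  have : NeZero N := ⟨by omega⟩
  have : Nontrivial (Space N) := inferInstance
  unfold radKer
  rw [integrable_fun_norm_addHaar volume
    (f := fun r => r * (Set.Iic 1).indicator (fun r => (r ^ N)⁻¹) r)]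
  have h2 : ∀ y ∈ Set.Ioi (0 : ℝ), (Set.Ioc 0 1).indicator (fun _ => (1 : ℝ)) y =
      y ^ (Module.finrank ℝ (Space N) - 1) •
      (y * (Set.Iic 1).indicator (fun r => (r ^ N)⁻¹) y) := by
    intro y hy
    have hy' : y ≠ 0 := ne_of_gt hy
    by_cases h : y ≤ 1
    · rw [Set.indicator_of_mem (show y ∈ Set.Ioc 0 1 from ⟨hy, h⟩), Set.indicator_of_mem (show y ∈ Set.Iic 1 from h),
        finrank_euclideanSpace, Fintype.card_fin, smul_eq_mul]
      obtain ⟨n, rfl⟩ : ∃ n, N = n + 1 := ⟨N - 1, by omega⟩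
      simp only [Nat.add_sub_cancel]
      field_simp
      ring
    · rw [Set.indicator_of_notMem (fun hh => h hh.2),
        Set.indicator_of_notMem (show y ∉ Set.Iic 1 from h), mul_zero, smul_zero]
  refine IntegrableOn.congr_fun ?_ h2 measurableSet_Ioi
  refine Integrable.integrableOn ?_
  exact (integrable_indicator_iff measurableSet_Ioc).2
    (integrableOn_const (hs := by simp))

lemma integrable_mul_conv_snd {F k : Space N → ℝ} (hF : Integrable F) (hk : Integrable k) :
    Integrable (fun p : Space N × Space N => F p.2 * k (p.1 - p.2)) (volume.prod volume) :=
  MeasurePreserving.integrable_comp_of_integrable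
    (measurePreserving_prod_sub_swap (volume : Measure (Space N)) volume) (hF.mul_prod hk)

lemma integral_mul_conv_snd {F k : Space N → ℝ} (hF : Integrable F) (hk : Integrable k) :
    ∫ p : Space N × Space N, F p.2 * k (p.1 - p.2) ∂(volume.prod volume) =
      (∫ x, F x) * ∫ z, k z := by
  have hmp := measurePreserving_prod_sub_swap (volume : Measure (Space N)) volume
  rw [← integral_prod_mul]
  conv_rhs => rw [← hmp.map_eq]
  rw [integral_map hmp.measurable.aemeasurable]
  rw [hmp.map_eq]
  exact (hF.mul_prod hk).aestronglyMeasurable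

lemma integrable_mul_conv_fst {F k : Space N → ℝ} (hF : Integrable F) (hk : Integrable k)
    (heven : ∀ z, k (-z) = k z) :
    Integrable (fun p : Space N × Space N => F p.1 * k (p.1 - p.2)) (volume.prod volume) := by
  have h := (integrable_mul_conv_snd hF hk).swap
  refine h.congr (Eventually.of_forall fun p => ?_)
  simp only [Function.comp_apply, Prod.fst_swap, Prod.snd_swap]
  rw [← heven, neg_sub]

lemma integral_mul_conv_fst {F k : Space N → ℝ} (hF : Integrable F) (hk : Integrable k)
    (heven : ∀ z, k (-z) = k z) :
    ∫ p : Space N × Space N, F p.1 * k (p.1 - p.2) ∂(volume.prod volume) =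
      (∫ x, F x) * ∫ z, k z := by
  rw [← integral_mul_conv_snd hF hk, ← integral_prod_swap]
  congr 1
  ext p
  simp only [Prod.fst_swap, Prod.snd_swap]
  rw [← heven, neg_sub]

/-- The bilinear form `∬ u(x) w(y) k(x - y) dx dy`. -/
noncomputable def convForm (k u w : Space N → ℝ) : ℝ :=
  ∫ p : Space N × Space N, u p.1 * w p.2 * k (p.1 - p.2) ∂(volume.prod volume)

/-- The energy form `∬ (u(x) - u(y)) (w(x) - w(y)) k(x - y) dx dy`. -/
noncomputable def diffForm (k u w : Space N → ℝ) : ℝ :=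
  ∫ p : Space N × Space N, (u p.1 - u p.2) * (w p.1 - w p.2) * k (p.1 - p.2)
    ∂(volume.prod volume)

lemma integrable_convForm {k u w : Space N → ℝ} (hu : Integrable u) (hw : Integrable w)
    (hk : Measurable k) {M : ℝ} (hM : ∀ z, |k z| ≤ M) :
    Integrable (fun p : Space N × Space N => u p.1 * w p.2 * k (p.1 - p.2))
      (volume.prod volume) :=
  (hu.mul_prod hw).mul_bdd (c := M) (hk.comp measurable_sub).aestronglyMeasurable
    (Eventually.of_forall fun _ => hM _)

lemma abs_convForm_le {k u w : Space N → ℝ} (hu : Integrable u) (hw : Integrable w)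
    {M : ℝ} (hM : ∀ z, |k z| ≤ M) :
    |convForm k u w| ≤ M * ((∫ x, |u x|) * ∫ x, |w x|) := by
  rw [convForm, ← integral_prod_mul, ← integral_const_mul, ← Real.norm_eq_abs]
  refine norm_integral_le_of_norm_le ((hu.abs.mul_prod hw.abs).const_mul M)
    (Eventually.of_forall fun p => ?_)
  rw [norm_mul, norm_mul, Real.norm_eq_abs, Real.norm_eq_abs, Real.norm_eq_abs, mul_comm]
  gcongr
  exact hM _

lemma convForm_comm {k : Space N → ℝ} (heven : ∀ z, k (-z) = k z) (u w : Space N → ℝ) :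
    convForm k u w = convForm k w u := by
  rw [convForm, convForm, ← integral_prod_swap]
  congr 1
  ext p
  simp only [Prod.fst_swap, Prod.snd_swap]
  rw [← heven, neg_sub, mul_comm (u p.2)]

/-- For an integrable bounded even kernel, expanding the product of differences
separates the mass of the kernel from the convolution. -/
lemma diffForm_eq {k u w : Space N → ℝ} (hu : Integrable u) (hw : Integrable w)
    (huw : Integrable (fun x => u x * w x)) (hk : Integrable k) (hkm : Measurable k)
    {M : ℝ} (hM : ∀ z, |k z| ≤ M) (heven : ∀ z, k (-z) = k z) :
    diffForm k u w = 2 * ((∫ x, u x * w x) * ∫ z, k z) - 2 * convForm k u w := by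
  have i1 := integrable_mul_conv_fst huw hk heven
  have i2 := integrable_mul_conv_snd huw hk
  have i3 := integrable_convForm hu hw hkm hM
  have i4 := integrable_convForm hw hu hkm hM
  have e1 := integral_mul_conv_fst huw hk heven
  have e2 := integral_mul_conv_snd huw hk
  have : diffForm k u w = ((∫ x, u x * w x) * ∫ z, k z) + ((∫ x, u x * w x) * ∫ z, k z)
      - convForm k u w - convForm k w u := by
    have i12 : Integrable (fun p : Space N × Space N => u p.1 * w p.1 * k (p.1 - p.2) +
      u p.2 * w p.2 * k (p.1 - p.2)) (volume.prod volume) := i1.add i2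
    have i123 : Integrable (fun p : Space N × Space N => u p.1 * w p.1 * k (p.1 - p.2) +
      u p.2 * w p.2 * k (p.1 - p.2) - u p.1 * w p.2 * k (p.1 - p.2)) (volume.prod volume) :=
      i12.sub i3
    conv_rhs => lhs; lhs; lhs; rw [← e1]
    conv_rhs => lhs; lhs; rhs; rw [← e2]
    rw [convForm, convForm, ← integral_add i1 i2, ← integral_sub i12 i3, ← integral_sub i123 i4]
    refine integral_congr_ae (Eventually.of_forall fun p => ?_)
    ring
  rw [this, convForm_comm heven w u]
  ring

/-! ### The space of functions of finite energy -/

lemma measurableSet_nearPairs : MeasurableSet (nearPairs N) :=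
  measurableSet_le (by fun_prop) measurable_const

lemma measurableSet_farPairs : MeasurableSet (farPairs N) :=
  measurableSet_le measurable_const (by fun_prop)

lemma indicator_nearPairs (f : Space N × Space N → ℝ) (p : Space N × Space N) :
    (nearPairs N).indicator (fun p => f p / ‖p.1 - p.2‖ ^ N) p =
      f p * radKer N (Set.Iic 1) (p.1 - p.2) := by
  by_cases h : ‖p.1 - p.2‖ ≤ 1
  · rw [Set.indicator_of_mem (show p ∈ nearPairs N from h),
      radKer_of_mem (show _ ∈ Set.Iic (1 : ℝ) from h), div_eq_mul_inv]
  · rw [Set.indicator_of_notMem (show p ∉ nearPairs N from h),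
      radKer_of_notMem (show _ ∉ Set.Iic (1 : ℝ) from h), mul_zero]

lemma indicator_farPairs (f : Space N × Space N → ℝ) (p : Space N × Space N) :
    (farPairs N).indicator (fun p => f p / ‖p.1 - p.2‖ ^ N) p =
      f p * radKer N (Set.Ici 1) (p.1 - p.2) := by
  by_cases h : 1 ≤ ‖p.1 - p.2‖
  · rw [Set.indicator_of_mem (show p ∈ farPairs N from h),
      radKer_of_mem (show _ ∈ Set.Ici (1 : ℝ) from h), div_eq_mul_inv]
  · rw [Set.indicator_of_notMem (show p ∉ farPairs N from h),
      radKer_of_notMem (show _ ∉ Set.Ici (1 : ℝ) from h), mul_zero]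

lemma logForm_eq (u w : Space N → ℝ) :
    logForm u w = cConst N / 2 * diffForm (radKer N (Set.Iic 1)) u w
      - cConst N * convForm (radKer N (Set.Ici 1)) u w + rhoConst N * ∫ x, u x * w x := by
  rw [logForm, energy, ← integral_indicator measurableSet_nearPairs,
    ← integral_indicator measurableSet_farPairs]
  simp only [indicator_nearPairs (fun p => (u p.1 - u p.2) * (w p.1 - w p.2)),
    indicator_farPairs (fun p => u p.1 * w p.2)]
  rfl

lemma cConst_pos (hN : 1 ≤ N) : 0 < cConst N := by
  have : (0 : ℝ) < N := by exact_mod_cast hN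
  exact mul_pos (Real.rpow_pos_of_pos Real.pi_pos _) (Real.Gamma_pos_of_pos (by positivity))

lemma lintegral_nearPairs (u : Space N → ℝ) :
    ∫⁻ p in nearPairs N, ENNReal.ofReal ((u p.1 - u p.2) ^ 2 / ‖p.1 - p.2‖ ^ N)
      ∂(volume.prod volume) =
    ∫⁻ p, ENNReal.ofReal ((u p.1 - u p.2) ^ 2 * radKer N (Set.Iic 1) (p.1 - p.2))
      ∂(volume.prod volume) := by
  rw [← lintegral_indicator measurableSet_nearPairs]
  congr 1
  ext p
  rw [← indicator_nearPairs (fun p => (u p.1 - u p.2) ^ 2)]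
  by_cases h : p ∈ nearPairs N <;> simp [h]

lemma aestronglyMeasurable_diff {u w : Space N → ℝ} (hu : AEMeasurable u) (hw : AEMeasurable w)
    {k : Space N → ℝ} (hk : Measurable k) :
    AEStronglyMeasurable (fun p : Space N × Space N =>
      (u p.1 - u p.2) * (w p.1 - w p.2) * k (p.1 - p.2)) (volume.prod volume) :=
  (((hu.comp_fst.sub hu.comp_snd).mul (hw.comp_fst.sub hw.comp_snd)).mul
    (hk.comp measurable_sub).aemeasurable).aestronglyMeasurable

lemma mem_hSpace_iff {Ω : Set (Space N)} {u : Space N → ℝ} :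
    u ∈ hSpace Ω ↔ AEMeasurable u ∧ (∀ x, x ∉ Ω → u x = 0) ∧
      Integrable (fun p : Space N × Space N =>
        (u p.1 - u p.2) * (u p.1 - u p.2) * radKer N (Set.Iic 1) (p.1 - p.2))
        (volume.prod volume) := by
  rw [hSpace, Set.mem_ofPred_eq, lintegral_nearPairs]
  refine and_congr_right fun hu => and_congr_right fun _ => ?_
  simp only [← pow_two]
  constructor
  · intro h
    refine ⟨by simpa only [← pow_two] using
      aestronglyMeasurable_diff hu hu (measurable_radKer measurableSet_Iic), ?_⟩
    rwa [hasFiniteIntegral_iff_ofReal]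
    exact Eventually.of_forall fun p => mul_nonneg (sq_nonneg _) (radKer_nonneg _ _)
  · intro h
    have := h.2
    rwa [hasFiniteIntegral_iff_ofReal] at this
    exact Eventually.of_forall fun p => mul_nonneg (sq_nonneg _) (radKer_nonneg _ _)

lemma integrable_diffForm {Ω : Set (Space N)} {u w : Space N → ℝ} (hu : u ∈ hSpace Ω)
    (hw : w ∈ hSpace Ω) {k : Space N → ℝ} (hk : Measurable k) (hk0 : ∀ z, 0 ≤ k z)
    (hk1 : ∀ z, k z ≤ radKer N (Set.Iic 1) z) :
    Integrable (fun p : Space N × Space N =>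
      (u p.1 - u p.2) * (w p.1 - w p.2) * k (p.1 - p.2)) (volume.prod volume) := by
  obtain ⟨hu1, -, hu3⟩ := mem_hSpace_iff.1 hu
  obtain ⟨hw1, -, hw3⟩ := mem_hSpace_iff.1 hw
  refine (hu3.add hw3).mono' (aestronglyMeasurable_diff hu1 hw1 hk)
    (Eventually.of_forall fun p => ?_)
  rw [norm_mul, Real.norm_of_nonneg (hk0 _), Real.norm_eq_abs]
  simp only [Pi.add_apply]
  rw [← add_mul]
  refine mul_le_mul ?_ (hk1 _) (hk0 _)
    (add_nonneg (mul_self_nonneg _) (mul_self_nonneg _))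
  rw [abs_le]
  constructor <;> nlinarith [sq_nonneg (u p.1 - u p.2 + (w p.1 - w p.2)),
    sq_nonneg (u p.1 - u p.2 - (w p.1 - w p.2))]

lemma integrable_diffForm_Iic {Ω : Set (Space N)} {u w : Space N → ℝ} (hu : u ∈ hSpace Ω)
    (hw : w ∈ hSpace Ω) {δ : ℝ} (hδ : δ ≤ 1) :
    Integrable (fun p : Space N × Space N =>
      (u p.1 - u p.2) * (w p.1 - w p.2) * radKer N (Set.Iic δ) (p.1 - p.2))
      (volume.prod volume) :=
  integrable_diffForm hu hw (measurable_radKer measurableSet_Iic) (radKer_nonneg _) fun z => by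
    rw [radKer_Iic_eq_add hδ]
    exact le_add_of_nonneg_right (radKer_nonneg _ _)

/-- `ℍ(Ω)` as a linear subspace of the functions on `ℝ^N`. -/
def hSub (Ω : Set (Space N)) : Submodule ℝ (Space N → ℝ) where
  carrier := hSpace Ω
  zero_mem' := mem_hSpace_iff.2 ⟨aemeasurable_const, fun _ _ => rfl, by simp⟩
  add_mem' := by
    intro u w hu hw
    have huw := integrable_diffForm_Iic hu hw le_rfl
    obtain ⟨hu1, hu2, hu3⟩ := mem_hSpace_iff.1 hu
    obtain ⟨hw1, hw2, hw3⟩ := mem_hSpace_iff.1 hw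
    refine mem_hSpace_iff.2 ⟨hu1.add hw1, fun x hx => by simp [hu2 x hx, hw2 x hx], ?_⟩
    refine ((hu3.add hw3).add (huw.const_mul 2)).congr (Eventually.of_forall fun p => ?_)
    simp only [Pi.add_apply]
    ring
  smul_mem' := by
    intro c u hu
    obtain ⟨hu1, hu2, hu3⟩ := mem_hSpace_iff.1 hu
    refine mem_hSpace_iff.2 ⟨hu1.const_mul c, fun x hx => by simp [hu2 x hx], ?_⟩
    refine (hu3.const_mul (c ^ 2)).congr (Eventually.of_forall fun p => ?_)
    simp only [Pi.smul_apply, smul_eq_mul]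
    ring

lemma mem_hSub {Ω : Set (Space N)} {u : Space N → ℝ} : u ∈ hSub Ω ↔ u ∈ hSpace Ω := Iff.rfl

lemma abs_mem_hSpace {Ω : Set (Space N)} {u : Space N → ℝ} (hu : u ∈ hSpace Ω) :
    (fun x => |u x|) ∈ hSpace Ω := by
  obtain ⟨hu1, hu2, hu3⟩ := mem_hSpace_iff.1 hu
  have hm : AEMeasurable fun x => |u x| := hu1.abs
  refine mem_hSpace_iff.2 ⟨hm, fun x hx => by simp [hu2 x hx], ?_⟩
  refine hu3.mono' (aestronglyMeasurable_diff hm hm (measurable_radKer measurableSet_Iic))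
    (Eventually.of_forall fun p => ?_)
  rw [← pow_two, ← pow_two, norm_mul, Real.norm_of_nonneg (radKer_nonneg _ _), norm_pow,
    Real.norm_eq_abs]
  refine mul_le_mul_of_nonneg_right ?_ (radKer_nonneg _ _)
  rw [← sq_abs (u p.1 - u p.2)]
  exact pow_le_pow_left₀ (abs_nonneg _) (abs_abs_sub_abs_le _ _) 2

lemma posPart_mem_hSpace {Ω : Set (Space N)} {u : Space N → ℝ} (hu : u ∈ hSpace Ω) :
    (fun x => max (u x) 0) ∈ hSpace Ω := by
  have h := (hSub Ω).smul_mem (2⁻¹ : ℝ) ((hSub Ω).add_mem hu (abs_mem_hSpace hu))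
  convert! mem_hSub.1 h using 1
  ext x
  simp only [Pi.smul_apply, Pi.add_apply, smul_eq_mul]
  rcases le_total (u x) 0 with h | h
  · rw [max_eq_right h, abs_of_nonpos h]; ring
  · rw [max_eq_left h, abs_of_nonneg h]; ring

/-- Finite energy near the diagonal makes one difference `u(h + ·) - u` square integrable, with
`|h| > 1/2`; its translates by multiples of `h` telescope, and after finitely many
steps `Ω` is moved off itself. -/
lemma memLp_two_of_mem_hSpace (hN : 1 ≤ N) {Ω : Set (Space N)} (hΩm : MeasurableSet Ω)
    (hΩ : Bornology.IsBounded Ω) {u : Space N → ℝ} (hu : u ∈ hSpace Ω) : MemLp u 2 volume := by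
  have : NeZero N := ⟨by omega⟩
  have : Nontrivial (Space N) := inferInstance
  obtain ⟨hu1, hu2, hu3⟩ := mem_hSpace_iff.1 hu
  have hmp := measurePreserving_prod_add_swap_right (volume : Measure (Space N)) volume
  have h1 := (hmp.integrable_comp_of_integrable hu3).prod_right_ae
  have hdense := Measure.dense_of_ae h1
  have hopen : IsOpen {h : Space N | 1 / 2 < ‖h‖ ∧ ‖h‖ < 1} :=
    (isOpen_lt continuous_const continuous_norm).inter (isOpen_lt continuous_norm continuous_const)
  have hnonempty : {h : Space N | 1 / 2 < ‖h‖ ∧ ‖h‖ < 1}.Nonempty := by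
    obtain ⟨h, hh⟩ := exists_norm_eq (Space N) (c := 3 / 4) (by norm_num)
    exact ⟨h, by rw [Set.mem_ofPred_eq, hh]; norm_num⟩
  obtain ⟨h, ⟨hh1, hh2⟩, hint⟩ := hdense.inter_open_nonempty _ hopen hnonempty
  simp only [Set.mem_ofPred_eq, Function.comp_apply] at hint
  have hker : ∀ y : Space N, radKer N (Set.Iic 1) (y - (h + y)) = (‖h‖ ^ N)⁻¹ := by
    intro y
    have : y - (h + y) = -h := by abel
    rw [this, radKer_neg, radKer_of_mem (show ‖h‖ ∈ Set.Iic (1 : ℝ) from hh2.le)]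
  simp only [hker] at hint
  have hpos : 0 < ‖h‖ := by linarith
  have hint2 : Integrable (fun y => (u (h + y) - u y) ^ 2) := by
    refine (hint.mul_const (‖h‖ ^ N)).congr (Eventually.of_forall fun y => ?_)
    simp only
    field_simp
    ring
  have hum : AEMeasurable (fun y => u (h + y)) :=
    hu1.comp_quasiMeasurePreserving (measurePreserving_add_left volume h).quasiMeasurePreserving
  have hD : MemLp (fun y => u (h + y) - u y) 2 volume :=
    (memLp_two_iff_integrable_sq (hum.sub hu1).aestronglyMeasurable).2 hint2
  have htel : ∀ K : ℕ, MemLp (fun y => u ((K : ℝ) • h + y) - u y) 2 volume := by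
    intro K
    induction K with
    | zero => simp
    | succ K ih =>
      have h2 := hD.comp_measurePreserving (measurePreserving_add_left volume ((K : ℝ) • h))
      convert! h2.add ih using 1
      ext y
      simp only [Function.comp_apply, Pi.add_apply]
      have : ((K + 1 : ℕ) : ℝ) • h + y = h + ((K : ℝ) • h + y) := by
        push_cast
        rw [add_smul, one_smul]
        abel
      rw [this]
      ring
  obtain ⟨R, hR⟩ := hΩ.subset_closedBall (0 : Space N)
  obtain ⟨K, hK⟩ := exists_nat_gt (4 * R)
  have h3 := ((htel K).neg).indicator hΩm
  convert! h3 using 1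
  ext x
  by_cases hx : x ∈ Ω
  · rw [Set.indicator_of_mem hx]
    have : (K : ℝ) • h + x ∉ Ω := by
      intro hx'
      have a1 := mem_closedBall_zero_iff.1 (hR hx)
      have a2 := mem_closedBall_zero_iff.1 (hR hx')
      have a3 : ‖(K : ℝ) • h‖ ≤ 2 * R := by
        calc ‖(K : ℝ) • h‖ = ‖((K : ℝ) • h + x) - x‖ := by rw [add_sub_cancel_right]
          _ ≤ _ := norm_sub_le _ _
          _ ≤ _ := by linarith
      rw [norm_smul, Real.norm_of_nonneg (Nat.cast_nonneg K)] at a3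
      have a4 : (0 : ℝ) ≤ K := Nat.cast_nonneg K
      nlinarith
    simp [hu2 _ this]
  · rw [Set.indicator_of_notMem hx, hu2 x hx]

lemma integrable_of_memLp_two {Ω : Set (Space N)} (hΩ : Bornology.IsBounded Ω)
    {u : Space N → ℝ} (hu : MemLp u 2 volume) (hu0 : ∀ x, x ∉ Ω → u x = 0) : Integrable u := by
  have : IsFiniteMeasure (volume.restrict Ω) := ⟨by
    rw [Measure.restrict_apply_univ]; exact hΩ.measure_lt_top⟩
  have h1 : IntegrableOn u Ω := (hu.restrict Ω).integrable (by norm_num)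
  refine (integrableOn_iff_integrable_of_support_subset ?_).1 h1
  intro x hx
  by_contra h
  exact hx (hu0 x h)

lemma integral_abs_sq_le {Ω : Set (Space N)} (hΩm : MeasurableSet Ω) (hΩ : Bornology.IsBounded Ω)
    {u : Space N → ℝ} (hu : MemLp u 2 volume) (hu0 : ∀ x, x ∉ Ω → u x = 0) :
    (∫ x, |u x|) ^ 2 ≤ volume.real Ω * ∫ x, u x * u x := by
  have hi := integrable_of_memLp_two hΩ hu hu0
  have hsq : Integrable (fun x => u x * u x) := hu.integrable_mul hu
  set I := ∫ x, |u x| with hI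
  set A := volume.real Ω with hA
  -- the polynomial `∫_Ω (|u| - t)²` in `t` is nonnegative
  have key : ∀ t : ℝ, 0 ≤ A * (t * t) + (-2 * I) * t + ∫ x, u x * u x := by
    intro t
    have h1 : Integrable (Ω.indicator fun _ : Space N => t ^ 2) :=
      (integrable_indicator_iff hΩm).2 (integrableOn_const (hs := hΩ.measure_lt_top.ne))
    have h2 : 0 ≤ ∫ x, (u x * u x - 2 * t * |u x| + Ω.indicator (fun _ => t ^ 2) x) := by
      refine integral_nonneg fun x => ?_
      simp only [Pi.zero_apply]
      by_cases hx : x ∈ Ω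
      · rw [Set.indicator_of_mem hx]
        nlinarith [sq_nonneg (|u x| - t), abs_mul_abs_self (u x)]
      · rw [Set.indicator_of_notMem hx, hu0 x hx]; simp
    have h3 : Integrable fun x => u x * u x - 2 * t * |u x| := hsq.sub (hi.abs.const_mul _)
    rw [integral_add h3 h1, integral_sub hsq (hi.abs.const_mul _),
      integral_const_mul, integral_indicator hΩm, setIntegral_const, smul_eq_mul] at h2
    linarith
  have := discrim_le_zero key
  rw [discrim] at this
  linarith

/-! ### Splitting the form at distance δ -/

/-- The kernel `|z|^{-N}` cut off to `|z| > δ`. It is the sum of the shell `δ < |z| ≤ 1` and of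
the range `|z| ≥ 1` of the far form; the double count on the unit sphere is harmless. -/
noncomputable def farKer (N : ℕ) (δ : ℝ) (z : Space N) : ℝ :=
  radKer N (Set.Ioc δ 1) z + radKer N (Set.Ici 1) z

lemma measurable_farKer (δ : ℝ) : Measurable (farKer N δ) :=
  (measurable_radKer measurableSet_Ioc).add (measurable_radKer measurableSet_Ici)

lemma abs_radKer_le {I : Set ℝ} {δ : ℝ} (hδ : 0 < δ) (hI : I ⊆ Set.Ici δ) (z : Space N) :
    |radKer N I z| ≤ (δ ^ N)⁻¹ := by
  rw [abs_of_nonneg (radKer_nonneg _ _)]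
  exact radKer_le hδ hI z

lemma abs_farKer_le {δ : ℝ} (hδ : 0 < δ) (hδ1 : δ ≤ 1) (z : Space N) :
    |farKer N δ z| ≤ 2 * (δ ^ N)⁻¹ := by
  rw [two_mul]
  exact (abs_add_le _ _).trans (add_le_add (abs_radKer_le hδ (fun r hr => hr.1.le) z)
    (abs_radKer_le hδ (Set.Ici_subset_Ici.2 hδ1) z))

lemma farKer_nonneg (δ : ℝ) (z : Space N) : 0 ≤ farKer N δ z :=
  add_nonneg (radKer_nonneg _ _) (radKer_nonneg _ _)

lemma inv_pow_le_farKer {δ D : ℝ} (hδ0 : 0 ≤ δ) {z : Space N} (h1 : δ < ‖z‖) (h2 : ‖z‖ ≤ D) :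
    (D ^ N)⁻¹ ≤ farKer N δ z := by
  have h0 : 0 < ‖z‖ := hδ0.trans_lt h1
  have h3 : (D ^ N)⁻¹ ≤ (‖z‖ ^ N)⁻¹ := by gcongr
  refine h3.trans ?_
  rcases le_total ‖z‖ 1 with h | h
  · rw [farKer, radKer_of_mem (I := Set.Ioc δ 1) ⟨h1, h⟩]
    exact le_add_of_nonneg_right (radKer_nonneg _ _)
  · rw [farKer, radKer_of_mem (show _ ∈ Set.Ici (1 : ℝ) from h)]
    exact le_add_of_nonneg_left (radKer_nonneg _ _)

/-- The coefficient of `∫ u w` when the range `|x - y| > δ` of the energy is expanded. It tends to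
infinity as `δ → 0`. -/
noncomputable def massCoeff (N : ℕ) (δ : ℝ) : ℝ :=
  cConst N * (∫ z, radKer N (Set.Ioc δ 1) z) + rhoConst N

lemma tendsto_massCoeff (hN : 1 ≤ N) : Tendsto (massCoeff N) (𝓝[>] 0) atTop :=
  tendsto_atTop_add_const_right _ _
    ((tendsto_integral_radKer_Ioc hN).const_mul_atTop (cConst_pos hN))

lemma exists_massCoeff_gt (hN : 1 ≤ N) (m : ℝ) {η : ℝ} (hη : 0 < η) :
    ∃ δ, 0 < δ ∧ δ ≤ 1 ∧ δ ≤ η ∧ m < massCoeff N δ := by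
  have h1 := (tendsto_massCoeff hN).eventually_gt_atTop m
  have h2 : Set.Ioo (0 : ℝ) (min 1 η) ∈ 𝓝[>] (0 : ℝ) := Ioo_mem_nhdsGT (lt_min one_pos hη)
  obtain ⟨δ, hδ, hm⟩ := ((eventually_of_mem h2 fun _ h => h).and h1).exists
  exact ⟨δ, hδ.1, hδ.2.le.trans (min_le_left _ _), hδ.2.le.trans (min_le_right _ _), hm⟩

lemma convForm_farKer {u w : Space N → ℝ} (hu : Integrable u) (hw : Integrable w) {δ : ℝ}
    (hδ : 0 < δ) : convForm (farKer N δ) u w =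
      convForm (radKer N (Set.Ioc δ 1)) u w + convForm (radKer N (Set.Ici 1)) u w := by
  rw [convForm, convForm, convForm, ← integral_add]
  · simp only [farKer, mul_add]
  · exact integrable_convForm hu hw (measurable_radKer measurableSet_Ioc)
      (abs_radKer_le hδ fun r hr => hr.1.le)
  · exact integrable_convForm hu hw (measurable_radKer measurableSet_Ici)
      (abs_radKer_le one_pos le_rfl)

variable {Ω : Set (Space N)}

/-- Splitting off the part `|x - y| ≤ δ` of the energy: what remains is a multiple of the `L²`
inner product minus a form with bounded kernel. -/
lemma logForm_split (hN : 1 ≤ N) (hΩm : MeasurableSet Ω) (hΩ : Bornology.IsBounded Ω)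
    {u w : Space N → ℝ} (hu : u ∈ hSpace Ω) (hw : w ∈ hSpace Ω) {δ : ℝ} (hδ : 0 < δ)
    (hδ1 : δ ≤ 1) :
    logForm u w = cConst N / 2 * diffForm (radKer N (Set.Iic δ)) u w +
      massCoeff N δ * (∫ x, u x * w x) - cConst N * convForm (farKer N δ) u w := by
  have hu2 := memLp_two_of_mem_hSpace hN hΩm hΩ hu
  have hw2 := memLp_two_of_mem_hSpace hN hΩm hΩ hw
  have hu1 := integrable_of_memLp_two hΩ hu2 hu.2.1
  have hw1 := integrable_of_memLp_two hΩ hw2 hw.2.1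
  have h1 : diffForm (radKer N (Set.Iic 1)) u w = diffForm (radKer N (Set.Iic δ)) u w +
      diffForm (radKer N (Set.Ioc δ 1)) u w := by
    rw [diffForm, diffForm, diffForm, ← integral_add (integrable_diffForm_Iic hu hw hδ1)]
    · simp only [radKer_Iic_eq_add hδ1, mul_add]
    · refine integrable_diffForm hu hw (measurable_radKer measurableSet_Ioc) (radKer_nonneg _)
        fun z => ?_
      rw [radKer_Iic_eq_add hδ1]
      exact le_add_of_nonneg_left (radKer_nonneg _ _)
  have h2 := diffForm_eq hu1 hw1 (hu2.integrable_mul hw2) (integrable_radKer_Ioc hδ)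
    (measurable_radKer measurableSet_Ioc) (abs_radKer_le hδ fun r hr => hr.1.le)
    (radKer_neg (Set.Ioc δ 1))
  rw [logForm_eq, h1, h2, convForm_farKer hu1 hw1 hδ, massCoeff]
  ring

lemma convForm_add_left {k u v w : Space N → ℝ} (hu : Integrable u) (hv : Integrable v)
    (hw : Integrable w) (hk : Measurable k) {M : ℝ} (hM : ∀ z, |k z| ≤ M) :
    convForm k (u + v) w = convForm k u w + convForm k v w := by
  rw [convForm, convForm, convForm, ← integral_add (integrable_convForm hu hw hk hM)
    (integrable_convForm hv hw hk hM)]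
  simp only [Pi.add_apply, add_mul]

lemma convForm_smul_left (k u w : Space N → ℝ) (c : ℝ) :
    convForm k (c • u) w = c * convForm k u w := by
  rw [convForm, convForm, ← integral_const_mul]
  simp only [Pi.smul_apply, smul_eq_mul, mul_assoc]

lemma logForm_comm (u w : Space N → ℝ) : logForm u w = logForm w u := by
  rw [logForm_eq, logForm_eq, convForm_comm (radKer_neg _) u w]
  simp only [diffForm, mul_comm (u _ - u _), mul_comm (u _) (w _)]

lemma logForm_add_left (hN : 1 ≤ N) (hΩm : MeasurableSet Ω) (hΩ : Bornology.IsBounded Ω)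
    {u v w : Space N → ℝ} (hu : u ∈ hSpace Ω) (hv : v ∈ hSpace Ω) (hw : w ∈ hSpace Ω) :
    logForm (u + v) w = logForm u w + logForm v w := by
  have hu2 := memLp_two_of_mem_hSpace hN hΩm hΩ hu
  have hv2 := memLp_two_of_mem_hSpace hN hΩm hΩ hv
  have hw2 := memLp_two_of_mem_hSpace hN hΩm hΩ hw
  have h1 : diffForm (radKer N (Set.Iic 1)) (u + v) w = diffForm (radKer N (Set.Iic 1)) u w +
      diffForm (radKer N (Set.Iic 1)) v w := by
    rw [diffForm, diffForm, diffForm, ← integral_add (integrable_diffForm_Iic hu hw le_rfl)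
      (integrable_diffForm_Iic hv hw le_rfl)]
    congr 1
    ext p
    simp only [Pi.add_apply]
    ring
  have h2 : ∫ x, (u + v) x * w x = (∫ x, u x * w x) + ∫ x, v x * w x := by
    have i1 : Integrable fun x => u x * w x := hu2.integrable_mul hw2
    have i2 : Integrable fun x => v x * w x := hv2.integrable_mul hw2
    rw [← integral_add i1 i2]
    simp only [Pi.add_apply, add_mul]
  rw [logForm_eq, logForm_eq, logForm_eq, h1, h2,
    convForm_add_left (integrable_of_memLp_two hΩ hu2 hu.2.1)
      (integrable_of_memLp_two hΩ hv2 hv.2.1) (integrable_of_memLp_two hΩ hw2 hw.2.1)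
      (measurable_radKer measurableSet_Ici) (abs_radKer_le one_pos le_rfl)]
  ring

lemma logForm_smul_left (c : ℝ) (u w : Space N → ℝ) :
    logForm (c • u) w = c * logForm u w := by
  have h1 : diffForm (radKer N (Set.Iic 1)) (c • u) w =
      c * diffForm (radKer N (Set.Iic 1)) u w := by
    rw [diffForm, diffForm, ← integral_const_mul]
    congr 1
    ext p
    simp only [Pi.smul_apply, smul_eq_mul]
    ring
  have h2 : ∫ x, (c • u) x * w x = c * ∫ x, u x * w x := by
    rw [← integral_const_mul]
    simp only [Pi.smul_apply, smul_eq_mul, mul_assoc]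
  rw [logForm_eq, logForm_eq, h1, h2, convForm_smul_left]
  ring

/-- The form of the logarithmic Laplacian as a bilinear form on `ℍ(Ω)`. -/
noncomputable def logBilin (hN : 1 ≤ N) (hΩm : MeasurableSet Ω) (hΩ : Bornology.IsBounded Ω) :
    hSub Ω →ₗ[ℝ] hSub Ω →ₗ[ℝ] ℝ :=
  LinearMap.mk₂ ℝ (fun u w => logForm (u : Space N → ℝ) w)
    (fun u v w => logForm_add_left hN hΩm hΩ u.2 v.2 w.2)
    (fun c u w => logForm_smul_left c _ _)
    (fun u v w => by
      rw [logForm_comm, logForm_comm (u : Space N → ℝ) v, logForm_comm (u : Space N → ℝ) w]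
      exact logForm_add_left hN hΩm hΩ v.2 w.2 u.2)
    (fun c u w => by
      rw [logForm_comm, logForm_comm (u : Space N → ℝ) w]
      exact logForm_smul_left c _ _)

@[simp]
lemma logBilin_apply (hN : 1 ≤ N) (hΩm : MeasurableSet Ω) (hΩ : Bornology.IsBounded Ω)
    (u w : hSub Ω) : logBilin hN hΩm hΩ u w = logForm (u : Space N → ℝ) w := rfl

/-- The embedding of `ℍ(Ω)` into `L²(Ω)`. -/
noncomputable def toL2 (hN : 1 ≤ N) (hΩm : MeasurableSet Ω) (hΩ : Bornology.IsBounded Ω) :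
    hSub Ω →ₗ[ℝ] Lp ℝ 2 (volume.restrict Ω) where
  toFun u := ((memLp_two_of_mem_hSpace hN hΩm hΩ u.2).restrict Ω).toLp (u : Space N → ℝ)
  map_add' _ _ := rfl
  map_smul' _ _ := rfl

lemma coeFn_toL2 (hN : 1 ≤ N) (hΩm : MeasurableSet Ω) (hΩ : Bornology.IsBounded Ω) (u : hSub Ω) :
    toL2 hN hΩm hΩ u =ᵐ[volume.restrict Ω] (u : Space N → ℝ) :=
  MemLp.coeFn_toLp ((memLp_two_of_mem_hSpace hN hΩm hΩ u.2).restrict Ω)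

lemma setIntegral_mul_eq {u w : Space N → ℝ} (hu : ∀ x, x ∉ Ω → u x = 0) :
    ∫ x in Ω, u x * w x = ∫ x, u x * w x :=
  setIntegral_eq_integral_of_forall_compl_eq_zero fun x hx => by rw [hu x hx, zero_mul]

lemma inner_toL2 (hN : 1 ≤ N) (hΩm : MeasurableSet Ω) (hΩ : Bornology.IsBounded Ω)
    (u w : hSub Ω) : inner ℝ (toL2 hN hΩm hΩ u) (toL2 hN hΩm hΩ w) =
      ∫ x, (u : Space N → ℝ) x * (w : Space N → ℝ) x := by
  rw [L2.inner_def, ← setIntegral_mul_eq u.2.2.1]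
  refine integral_congr_ae ?_
  filter_upwards [coeFn_toL2 hN hΩm hΩ u, coeFn_toL2 hN hΩm hΩ w] with x h1 h2
  rw [h1, h2]
  simp [mul_comm]

lemma norm_toL2_sq (hN : 1 ≤ N) (hΩm : MeasurableSet Ω) (hΩ : Bornology.IsBounded Ω)
    (u : hSub Ω) : ‖toL2 hN hΩm hΩ u‖ ^ 2 = ∫ x, (u : Space N → ℝ) x * (u : Space N → ℝ) x := by
  rw [← real_inner_self_eq_norm_sq, inner_toL2]

lemma integral_abs_le_toL2 (hN : 1 ≤ N) (hΩm : MeasurableSet Ω) (hΩ : Bornology.IsBounded Ω)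
    (u : hSub Ω) : ∫ x, |(u : Space N → ℝ) x| ≤ √(volume.real Ω) * ‖toL2 hN hΩm hΩ u‖ := by
  refine abs_le_of_sq_le_sq' ?_ (by positivity) |>.2
  rw [mul_pow, Real.sq_sqrt measureReal_nonneg, norm_toL2_sq]
  exact integral_abs_sq_le hΩm hΩ (memLp_two_of_mem_hSpace hN hΩm hΩ u.2) u.2.2.1

lemma hSub_integrable (hN : 1 ≤ N) (hΩm : MeasurableSet Ω) (hΩ : Bornology.IsBounded Ω)
    (u : hSub Ω) : Integrable (u : Space N → ℝ) :=
  integrable_of_memLp_two hΩ (memLp_two_of_mem_hSpace hN hΩm hΩ u.2) u.2.2.1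

lemma abs_convForm_le_toL2 (hN : 1 ≤ N) (hΩm : MeasurableSet Ω) (hΩ : Bornology.IsBounded Ω)
    {k : Space N → ℝ} {M : ℝ} (hM : ∀ z, |k z| ≤ M) (u w : hSub Ω) :
    |convForm k (u : Space N → ℝ) w| ≤
      M * volume.real Ω * (‖toL2 hN hΩm hΩ u‖ * ‖toL2 hN hΩm hΩ w‖) := by
  have hM0 : 0 ≤ M := (abs_nonneg _).trans (hM 0)
  have h1 := integral_abs_le_toL2 hN hΩm hΩ u
  have h2 := integral_abs_le_toL2 hN hΩm hΩ w
  calc _ ≤ M * ((∫ x, |(u : Space N → ℝ) x|) * ∫ x, |(w : Space N → ℝ) x|) :=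
        abs_convForm_le (hSub_integrable hN hΩm hΩ u) (hSub_integrable hN hΩm hΩ w) hM
    _ ≤ M * ((√(volume.real Ω) * ‖toL2 hN hΩm hΩ u‖) *
          (√(volume.real Ω) * ‖toL2 hN hΩm hΩ w‖)) := by
        gcongr
    _ = M * (√(volume.real Ω) * √(volume.real Ω)) *
          (‖toL2 hN hΩm hΩ u‖ * ‖toL2 hN hΩm hΩ w‖) := by ring
    _ = _ := by rw [Real.mul_self_sqrt measureReal_nonneg]

lemma diffForm_self_nonneg (I : Set ℝ) (u : Space N → ℝ) : 0 ≤ diffForm (radKer N I) u u :=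
  integral_nonneg fun _ => mul_nonneg (mul_self_nonneg _) (radKer_nonneg _ _)

lemma exists_logBilin_ge (hN : 1 ≤ N) (hΩm : MeasurableSet Ω) (hΩ : Bornology.IsBounded Ω) :
    ∃ C, 0 ≤ C ∧ ∀ u, -C * ‖toL2 hN hΩm hΩ u‖ ^ 2 ≤ logBilin hN hΩm hΩ u u := by
  have hc := cConst_pos hN
  refine ⟨|rhoConst N| + cConst N * (((1 : ℝ) ^ N)⁻¹ * volume.real Ω), by positivity,
    fun u => ?_⟩
  have h1 := abs_convForm_le_toL2 hN hΩm hΩ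
    (abs_radKer_le (N := N) (I := Set.Ici 1) one_pos le_rfl) u u
  have h2 := (abs_le.1 h1).2
  have h3 := diffForm_self_nonneg (N := N) (Set.Iic 1) u
  rw [logBilin_apply, logForm_eq, ← norm_toL2_sq hN hΩm hΩ]
  have h4 : -|rhoConst N| * ‖toL2 hN hΩm hΩ u‖ ^ 2 ≤ rhoConst N * ‖toL2 hN hΩm hΩ u‖ ^ 2 := by
    gcongr
    exact neg_abs_le _
  have h5 := mul_le_mul_of_nonneg_left h2 hc.le
  have h6 : 0 ≤ cConst N / 2 * diffForm (radKer N (Set.Iic 1)) (u : Space N → ℝ) u := by positivity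
  nlinarith

/-! ### Compactness of the embedding into L² -/

lemma exists_weakly_convergent_subseq {H : Type*} [NormedAddCommGroup H] [InnerProductSpace ℝ H]
    [TopologicalSpace.SeparableSpace H] {x : ℕ → H} (hx : ∀ n, ‖x n‖ ≤ 1) :
    ∃ φ : ℕ → ℕ, StrictMono φ ∧
      ∀ h : H, ∃ l : ℝ, Tendsto (fun n => inner ℝ (x (φ n)) h) atTop (𝓝 l) := by
  obtain ⟨f, -, φ, hφ, hf⟩ := WeakDual.isSeqCompact_closedBall ℝ H 0 1
    (x := fun n => StrongDual.toWeakDual (innerSL ℝ (x n))) (fun n => by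
      rw [Set.mem_preimage, mem_closedBall_zero_iff]
      simpa using hx n)
  refine ⟨φ, hφ, fun h => ⟨f h, ?_⟩⟩
  have := ((WeakDual.eval_continuous (𝕜 := ℝ) h).tendsto f).comp hf
  exact this

lemma memLp_two_kernel (hΩ : Bornology.IsBounded Ω) {k : Space N → ℝ} (hk : Measurable k) {M : ℝ}
    (hM : ∀ z, |k z| ≤ M) (x : Space N) :
    MemLp (fun y => k (x - y)) 2 (volume.restrict Ω) := by
  have : IsFiniteMeasure (volume.restrict Ω) := ⟨by
    rw [Measure.restrict_apply_univ]; exact hΩ.measure_lt_top⟩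
  exact MemLp.of_bound (hk.comp (measurable_const.sub measurable_id)).aestronglyMeasurable M
    (Eventually.of_forall fun y => hM _)

/-- A convolution operator with bounded kernel on a bounded set turns weak convergence into
convergence of the quadratic form. -/
lemma eventually_convForm_sub_le (hN : 1 ≤ N) (hΩm : MeasurableSet Ω)
    (hΩ : Bornology.IsBounded Ω) {k : Space N → ℝ} (hk : Measurable k) {M : ℝ}
    (hM : ∀ z, |k z| ≤ M) {u : ℕ → hSub Ω} (hu : ∀ n, ‖toL2 hN hΩm hΩ (u n)‖ ≤ 1)
    (hweak : ∀ h, ∃ l : ℝ, Tendsto (fun n => inner ℝ (toL2 hN hΩm hΩ (u n)) h) atTop (𝓝 l))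
    {η : ℝ} (hη : 0 < η) :
    ∃ n₀, ∀ n ≥ n₀, ∀ m ≥ n₀,
      convForm k (u n - u m : hSub Ω) (u n - u m : hSub Ω) ≤ η := by
  have : IsFiniteMeasure (volume.restrict Ω) := ⟨by
    rw [Measure.restrict_apply_univ]; exact hΩ.measure_lt_top⟩
  have hM0 : 0 ≤ M := (abs_nonneg _).trans (hM 0)
  let T : (Space N → ℝ) → Space N → ℝ := fun w x => ∫ y, w y * k (x - y)
  have hTinner : ∀ (w : hSub Ω) x, T w x =
      inner ℝ (toL2 hN hΩm hΩ w) ((memLp_two_kernel hΩ hk hM x).toLp _) := by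
    intro w x
    rw [L2.inner_def]
    simp only [T]
    rw [← setIntegral_mul_eq w.2.2.1]
    refine integral_congr_ae ?_
    filter_upwards [coeFn_toL2 hN hΩm hΩ w, (memLp_two_kernel hΩ hk hM x).coeFn_toLp]
      with y h1 h2
    rw [h1, h2]
    simp [mul_comm]
  choose t ht using fun x => hweak ((memLp_two_kernel hΩ hk hM x).toLp _)
  have hTt : ∀ x, Tendsto (fun n => T (u n) x) atTop (𝓝 (t x)) := by
    intro x
    simpa only [hTinner] using ht x
  set R := √(volume.real Ω) * M with hR
  have hTb : ∀ n x, |T (u n) x| ≤ R := by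
    intro n x
    have h1 : |T (u n) x| ≤ ∫ y, |(u n : Space N → ℝ) y| * M := by
      rw [← Real.norm_eq_abs]
      refine norm_integral_le_of_norm_le ((hSub_integrable hN hΩm hΩ (u n)).abs.mul_const M)
        (Eventually.of_forall fun y => ?_)
      rw [norm_mul, Real.norm_eq_abs, Real.norm_eq_abs]
      gcongr
      exact hM _
    rw [integral_mul_const] at h1
    refine h1.trans (mul_le_mul_of_nonneg_right ?_ hM0)
    refine (integral_abs_le_toL2 hN hΩm hΩ (u n)).trans ?_
    exact mul_le_of_le_one_right (Real.sqrt_nonneg _) (hu n)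
  have htb : ∀ x, |t x| ≤ R := fun x =>
    le_of_tendsto (hTt x).abs (Eventually.of_forall fun n => hTb n x)
  have hTm : ∀ n, AEStronglyMeasurable (T (u n)) volume := fun n =>
    ((hSub_integrable hN hΩm hΩ (u n)).aestronglyMeasurable.comp_snd.mul
      (hk.comp measurable_sub).aestronglyMeasurable).integral_prod_right'
  have htm : AEStronglyMeasurable t volume :=
    aestronglyMeasurable_of_tendsto_ae atTop hTm (Eventually.of_forall hTt)
  have hdct : Tendsto (fun n => ∫ x in Ω, (T (u n) x - t x) ^ 2) atTop (𝓝 0) := by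
    have h0 : (0 : ℝ) = ∫ x in Ω, (0 : ℝ) := by simp
    rw [h0]
    refine tendsto_integral_of_dominated_convergence (fun _ => (2 * R) ^ 2)
      (fun n => (((hTm n).sub htm).pow 2).restrict) (integrable_const _)
      (fun n => Eventually.of_forall fun x => ?_) (Eventually.of_forall fun x => ?_)
    · rw [norm_pow, Real.norm_eq_abs]
      refine pow_le_pow_left₀ (abs_nonneg _) ?_ 2
      refine (abs_sub _ _).trans ?_
      linarith [hTb n x, htb x]
    · have := ((hTt x).sub_const (t x)).pow 2
      simpa using this
  have hint : ∀ n, IntegrableOn (fun x => (T (u n) x - t x) ^ 2) Ω := by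
    intro n
    refine Integrable.of_bound (C := (2 * R) ^ 2) (((hTm n).sub htm).pow 2).restrict
      (Eventually.of_forall fun x => ?_)
    rw [norm_pow, Real.norm_eq_abs]
    refine pow_le_pow_left₀ (abs_nonneg _) ?_ 2
    refine (abs_sub _ _).trans ?_
    linarith [hTb n x, htb x]
  have hev : ∀ᶠ n in atTop, ∫ x in Ω, (T (u n) x - t x) ^ 2 < η ^ 2 / 16 :=
    hdct.eventually_lt_const (by positivity)
  obtain ⟨n₀, hn₀⟩ := eventually_atTop.1 hev
  refine ⟨n₀, fun n hn m hm => ?_⟩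
  set w : hSub Ω := u n - u m with hw
  have hwi := hSub_integrable hN hΩm hΩ w
  have hTw : ∀ x, T w x = T (u n) x - T (u m) x := by
    intro x
    rw [hTinner, hTinner, hTinner, hw, map_sub, inner_sub_left]
  have e1 : convForm k w w = ∫ x in Ω, (w : Space N → ℝ) x * T w x := by
    rw [convForm, integral_prod _ (integrable_convForm hwi hwi hk hM),
      setIntegral_mul_eq w.2.2.1]
    congr 1
    ext x
    simp only [T, mul_assoc]
    rw [integral_const_mul]
  have hwsq : IntegrableOn (fun x => (w : Space N → ℝ) x * (w : Space N → ℝ) x) Ω :=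
    ((memLp_two_of_mem_hSpace hN hΩm hΩ w.2).integrable_mul
      (memLp_two_of_mem_hSpace hN hΩm hΩ w.2)).integrableOn
  have hwn : ∫ x in Ω, (w : Space N → ℝ) x * (w : Space N → ℝ) x ≤ 4 := by
    rw [setIntegral_mul_eq w.2.2.1, ← norm_toL2_sq hN hΩm hΩ]
    have h1 : ‖toL2 hN hΩm hΩ w‖ ≤ 2 := by
      rw [hw, map_sub]
      refine (norm_sub_le _ _).trans ?_
      linarith [hu n, hu m]
    nlinarith [norm_nonneg (toL2 hN hΩm hΩ w)]
  -- weighted arithmetic-geometric mean inequality; the weight balances the two halves of `η`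
  have e2 : ∫ x in Ω, (w : Space N → ℝ) x * T w x ≤ ∫ x in Ω,
      (η / 8 * ((w : Space N → ℝ) x * (w : Space N → ℝ) x) +
        (4 / η * (T (u n) x - t x) ^ 2 + 4 / η * (T (u m) x - t x) ^ 2)) := by
    refine integral_mono ?_ ?_ fun x => ?_
    · refine (hwi.mul_bdd (c := 2 * R) ?_ (Eventually.of_forall fun x => ?_)).integrableOn
      · exact ((hTm n).sub (hTm m)).congr (Eventually.of_forall fun x => (hTw x).symm)
      · rw [hTw, Real.norm_eq_abs]
        refine (abs_sub _ _).trans ?_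
        linarith [hTb n x, hTb m x]
    · exact (hwsq.const_mul _).add (((hint n).const_mul _).add ((hint m).const_mul _))
    · simp only
      rw [hTw]
      set a := (w : Space N → ℝ) x
      set b := T (u n) x - t x
      set c := T (u m) x - t x
      have h1 : T (u n) x - T (u m) x = b - c := by simp only [b, c]; ring
      have h2 : η / 8 * (a * a) + (4 / η * b ^ 2 + 4 / η * c ^ 2) - a * (b - c) =
          (η * a - 4 * (b - c)) ^ 2 / (8 * η) + 2 / η * (b + c) ^ 2 := by
        field_simp
        ring
      have h3 : 0 ≤ (η * a - 4 * (b - c)) ^ 2 / (8 * η) + 2 / η * (b + c) ^ 2 := by positivity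
      rw [h1]
      linarith
  have hsum : IntegrableOn (fun x => 4 / η * (T (u n) x - t x) ^ 2 +
      4 / η * (T (u m) x - t x) ^ 2) Ω := ((hint n).const_mul _).add ((hint m).const_mul _)
  rw [integral_add (hwsq.const_mul _) hsum,
    integral_add ((hint n).const_mul _) ((hint m).const_mul _), integral_const_mul,
    integral_const_mul, integral_const_mul] at e2
  have h1 := hn₀ n hn
  have h2 := hn₀ m hm
  have h3 : 4 / η * ∫ x in Ω, (T (u n) x - t x) ^ 2 ≤ 4 / η * (η ^ 2 / 16) := by gcongr
  have h4 : 4 / η * ∫ x in Ω, (T (u m) x - t x) ^ 2 ≤ 4 / η * (η ^ 2 / 16) := by gcongr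
  have h5 : 4 / η * (η ^ 2 / 16) = η / 4 := by field_simp; norm_num
  have h6 : η / 8 * ∫ x in Ω, (w : Space N → ℝ) x * (w : Space N → ℝ) x ≤ η / 8 * 4 := by gcongr
  rw [e1]
  linarith

lemma diffForm_eq_toReal {u : Space N → ℝ} (hu : u ∈ hSpace Ω) :
    ∫⁻ p, ENNReal.ofReal ((u p.1 - u p.2) ^ 2 * radKer N (Set.Iic 1) (p.1 - p.2))
      ∂(volume.prod volume) = ENNReal.ofReal (diffForm (radKer N (Set.Iic 1)) u u) := by
  rw [diffForm, ofReal_integral_eq_lintegral_ofReal (mem_hSpace_iff.1 hu).2.2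
    (Eventually.of_forall fun p => mul_nonneg (mul_self_nonneg _) (radKer_nonneg _ _))]
  simp only [pow_two]

/-- Lower semicontinuity of the energy under almost everywhere convergence (Fatou). -/
lemma energy_lowerSemicontinuous {u : ℕ → Space N → ℝ} (hu : ∀ n, u n ∈ hSpace Ω)
    {v : Space N → ℝ} (hlim : ∀ᵐ x, Tendsto (fun n => u n x) atTop (𝓝 (v x)))
    {b : ℝ} (hb : ∀ᶠ n in atTop, diffForm (radKer N (Set.Iic 1)) (u n) (u n) ≤ b) :
    ∫⁻ p, ENNReal.ofReal ((v p.1 - v p.2) ^ 2 * radKer N (Set.Iic 1) (p.1 - p.2))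
      ∂(volume.prod volume) ≤ ENNReal.ofReal b := by
  have h1 : ∀ᵐ p : Space N × Space N ∂(volume.prod volume),
      Tendsto (fun n => u n p.1) atTop (𝓝 (v p.1)) :=
    Measure.quasiMeasurePreserving_fst.ae hlim
  have h2 : ∀ᵐ p : Space N × Space N ∂(volume.prod volume),
      Tendsto (fun n => u n p.2) atTop (𝓝 (v p.2)) :=
    Measure.quasiMeasurePreserving_snd.ae hlim
  calc _ = ∫⁻ p, liminf (fun n => ENNReal.ofReal
          ((u n p.1 - u n p.2) ^ 2 * radKer N (Set.Iic 1) (p.1 - p.2))) atTop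
          ∂(volume.prod volume) := by
        refine lintegral_congr_ae ?_
        filter_upwards [h1, h2] with p hp1 hp2
        exact (ENNReal.tendsto_ofReal (((hp1.sub hp2).pow 2).mul_const _)).liminf_eq.symm
    _ ≤ liminf (fun n => ∫⁻ p, ENNReal.ofReal
          ((u n p.1 - u n p.2) ^ 2 * radKer N (Set.Iic 1) (p.1 - p.2))
          ∂(volume.prod volume)) atTop := by
        refine lintegral_liminf_le' fun n => AEMeasurable.ennreal_ofReal ?_
        have hm := (mem_hSpace_iff.1 (hu n)).1
        simpa only [pow_two] using
          (aestronglyMeasurable_diff hm hm (measurable_radKer measurableSet_Iic)).aemeasurable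
    _ ≤ ENNReal.ofReal b := by
        refine liminf_le_of_frequently_le' (Eventually.frequently ?_)
        filter_upwards [hb] with n hn
        rw [diffForm_eq_toReal (hu n)]
        exact ENNReal.ofReal_le_ofReal hn

lemma convForm_self_sub_le (hN : 1 ≤ N) (hΩm : MeasurableSet Ω) (hΩ : Bornology.IsBounded Ω)
    {k : Space N → ℝ} (hk : Measurable k) (heven : ∀ z, k (-z) = k z) {M : ℝ}
    (hM : ∀ z, |k z| ≤ M) (u v : hSub Ω) :
    |convForm k (u : Space N → ℝ) u - convForm k (v : Space N → ℝ) v| ≤ M * volume.real Ω *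
      (‖toL2 hN hΩm hΩ u - toL2 hN hΩm hΩ v‖ *
        (‖toL2 hN hΩm hΩ u‖ + ‖toL2 hN hΩm hΩ v‖)) := by
  have iu := hSub_integrable hN hΩm hΩ u
  have iv := hSub_integrable hN hΩm hΩ v
  have id := hSub_integrable hN hΩm hΩ (u - v)
  have hadd : (u : Space N → ℝ) = ((u - v : hSub Ω) : Space N → ℝ) + v := by simp
  have h1 : convForm k (u : Space N → ℝ) u =
      convForm k (u - v : hSub Ω) u + convForm k (v : Space N → ℝ) u := by
    rw [← convForm_add_left id iv iu hk hM, ← hadd]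
  have h2 : convForm k (v : Space N → ℝ) u =
      convForm k (u - v : hSub Ω) v + convForm k (v : Space N → ℝ) v := by
    rw [convForm_comm heven, ← convForm_add_left id iv iv hk hM, ← hadd]
  have h3 := abs_convForm_le_toL2 hN hΩm hΩ hM (u - v) u
  have h4 := abs_convForm_le_toL2 hN hΩm hΩ hM (u - v) v
  rw [map_sub] at h3 h4
  have h5 : convForm k (u : Space N → ℝ) u - convForm k (v : Space N → ℝ) v =
      convForm k (u - v : hSub Ω) u + convForm k (u - v : hSub Ω) v := by linarith
  rw [h5]
  refine (abs_add_le _ _).trans ?_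
  linarith

/-- The form is lower semicontinuous in `L²(Ω)`, and its sublevel sets are closed. -/
lemma exists_limit_mem_hSub (hN : 1 ≤ N) (hΩm : MeasurableSet Ω) (hΩ : Bornology.IsBounded Ω)
    {u : ℕ → hSub Ω} {c : ℝ} (hu1 : ∀ n, ‖toL2 hN hΩm hΩ (u n)‖ = 1)
    (hc : Tendsto (fun n => logBilin hN hΩm hΩ (u n) (u n)) atTop (𝓝 c))
    {x : Lp ℝ 2 (volume.restrict Ω)}
    (hx : Tendsto (fun n => toL2 hN hΩm hΩ (u n)) atTop (𝓝 x)) :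
    ∃ v, toL2 hN hΩm hΩ v = x ∧ logBilin hN hΩm hΩ v v ≤ c := by
  have hcN := cConst_pos hN
  obtain ⟨φ, hφ, hae⟩ := (tendstoInMeasure_of_tendsto_Lp hx).exists_seq_tendsto_ae
  set v : Space N → ℝ := Ω.indicator x with hv
  have hvm : AEMeasurable v := by
    rw [hv, aemeasurable_indicator_iff hΩm]
    exact (Lp.aestronglyMeasurable x).aemeasurable
  have hlim : ∀ᵐ y, Tendsto (fun n => (u (φ n) : Space N → ℝ) y) atTop (𝓝 (v y)) := by
    have h1 : ∀ᵐ y ∂(volume.restrict Ω),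
        Tendsto (fun n => (u (φ n) : Space N → ℝ) y) atTop (𝓝 (x y)) := by
      have h2 := ae_all_iff.2 fun n => coeFn_toL2 hN hΩm hΩ (u n)
      filter_upwards [hae, h2] with y hy hy2
      simpa only [hy2] using hy
    rw [ae_restrict_iff' hΩm] at h1
    filter_upwards [h1] with y hy
    by_cases hyΩ : y ∈ Ω
    · rw [hv, Set.indicator_of_mem hyΩ]
      exact hy hyΩ
    · rw [hv, Set.indicator_of_notMem hyΩ]
      simp only [(u _).2.2.1 y hyΩ]
      exact tendsto_const_nhds
  set E : (Space N → ℝ) → ℝ := fun w => diffForm (radKer N (Set.Iic 1)) w w with hE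
  set B : (Space N → ℝ) → ℝ := fun w => convForm (radKer N (Set.Ici 1)) w w with hB
  have hform : ∀ w : hSub Ω, logBilin hN hΩm hΩ w w =
      cConst N / 2 * E w - cConst N * B w + rhoConst N * ‖toL2 hN hΩm hΩ w‖ ^ 2 := by
    intro w
    rw [logBilin_apply, logForm_eq, norm_toL2_sq]
  have hEeq : ∀ n, E (u n) = 2 / cConst N *
      (logBilin hN hΩm hΩ (u n) (u n) + cConst N * B (u n) - rhoConst N) := by
    intro n
    rw [hform, hu1]
    field_simp
    ring
  have hker := abs_radKer_le (N := N) (I := Set.Ici 1) one_pos le_rfl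
  have hφ' := hφ.tendsto_atTop
  -- a first, crude bound on the energies puts the limit into `ℍ(Ω)`
  have hvΩ : v ∈ hSpace Ω := by
    refine ⟨hvm, fun y hy => Set.indicator_of_notMem hy _, ?_⟩
    rw [lintegral_nearPairs]
    have hb : ∀ᶠ n in atTop, E (u (φ n)) ≤ 2 / cConst N *
        (c + 1 + cConst N * (((1 : ℝ) ^ N)⁻¹ * volume.real Ω * (1 * 1)) - rhoConst N) := by
      filter_upwards [(hc.comp hφ').eventually_le_const (lt_add_one c)] with n hn
      rw [hEeq]
      simp only [Function.comp_apply] at hn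
      have := (abs_le.1 (abs_convForm_le_toL2 hN hΩm hΩ hker (u (φ n)) (u (φ n)))).2
      rw [hu1] at this
      gcongr
    exact (energy_lowerSemicontinuous (fun n => (u (φ n)).2) hlim hb).trans_lt
      ENNReal.ofReal_lt_top
  set V : hSub Ω := ⟨v, hvΩ⟩ with hV
  have hVx : toL2 hN hΩm hΩ V = x := by
    refine Lp.ext ?_
    filter_upwards [coeFn_toL2 hN hΩm hΩ V, ae_restrict_mem hΩm] with y h1 h2
    rw [h1]
    exact Set.indicator_of_mem h2 _
  have hV1 : ‖toL2 hN hΩm hΩ V‖ = 1 := by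
    have := hx.norm
    simp only [hu1] at this
    rw [hVx]
    exact (tendsto_nhds_unique this tendsto_const_nhds)
  refine ⟨V, hVx, ?_⟩
  have hBlim : Tendsto (fun n => B (u (φ n))) atTop (𝓝 (B V)) := by
    rw [tendsto_iff_dist_tendsto_zero]
    have h1 : Tendsto (fun n => ((1 : ℝ) ^ N)⁻¹ * volume.real Ω *
        (‖toL2 hN hΩm hΩ (u (φ n)) - x‖ * (1 + 1))) atTop (𝓝 0) := by
      have h2 := tendsto_iff_norm_sub_tendsto_zero.1 (hx.comp hφ')
      simpa using (h2.mul_const (1 + 1 : ℝ)).const_mul (((1 : ℝ) ^ N)⁻¹ * volume.real Ω)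
    refine squeeze_zero (fun _ => dist_nonneg) (fun n => ?_) h1
    have := convForm_self_sub_le hN hΩm hΩ (measurable_radKer (N := N) measurableSet_Ici)
      (radKer_neg _) hker (u (φ n)) V
    rw [hu1, hV1, hVx] at this
    exact this
  have hElim : Tendsto (fun n => E (u (φ n))) atTop
      (𝓝 (2 / cConst N * (c + cConst N * B V - rhoConst N))) := by
    simp only [hEeq]
    exact (((hc.comp hφ').add (hBlim.const_mul _)).sub_const _).const_mul _
  have hEV : E V ≤ 2 / cConst N * (c + cConst N * B V - rhoConst N) := by
    refine le_of_forall_pos_le_add fun ε hε => ?_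
    have h1 := energy_lowerSemicontinuous (fun n => (u (φ n)).2) hlim
      (hElim.eventually_le_const (lt_add_of_pos_right _ hε))
    rw [diffForm_eq_toReal hvΩ, ENNReal.ofReal_le_ofReal_iff'] at h1
    rcases h1 with h1 | h1
    · exact h1
    · refine h1.trans (ge_of_tendsto' hElim fun n => ?_) |>.trans (by linarith)
      exact diffForm_self_nonneg _ _
  rw [hform, hV1]
  have := mul_le_mul_of_nonneg_left hEV (by positivity : 0 ≤ cConst N / 2)
  have h2 : cConst N / 2 * (2 / cConst N * (c + cConst N * B V - rhoConst N)) =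
      c + cConst N * B V - rhoConst N := by field_simp
  linarith

/-- Compactness of the embedding `ℍ(Ω) → L²(Ω)`: along a weakly convergent sequence
the forms with kernel cut off to `|z| > δ` converge, while the remaining part of the form controls
a multiple of the `L²` norm that is as large as desired for small `δ`. -/
lemma formCompact_logBilin (hN : 1 ≤ N) (hΩm : MeasurableSet Ω) (hΩ : Bornology.IsBounded Ω) :
    FormCompact (toL2 hN hΩm hΩ) (logBilin hN hΩm hΩ) := by
  intro u c hu hc
  have hcN := cConst_pos hN
  obtain ⟨C, hC0, hC⟩ := exists_logBilin_ge hN hΩm hΩ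
  have : Fact ((1 : ℝ≥0∞) ≤ 2) := ⟨by norm_num⟩
  have : Fact ((2 : ℝ≥0∞) ≠ ∞) := ⟨by norm_num⟩
  obtain ⟨φ, hφ, hweak⟩ := exists_weakly_convergent_subseq
    (x := fun n => toL2 hN hΩm hΩ (u n)) fun n => (hu n).le
  obtain ⟨b, hb⟩ := hc.bddAbove_range
  have hb' : ∀ n, logBilin hN hΩm hΩ (u n) (u n) ≤ b := fun n => hb ⟨n, rfl⟩
  have hcauchy : CauchySeq fun n => toL2 hN hΩm hΩ (u (φ n)) := by
    rw [Metric.cauchySeq_iff]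
    intro ε hε
    obtain ⟨δ, hδ, hδ1, -, hm⟩ := exists_massCoeff_gt hN
      (max 0 ((4 * b + 4 * C + 1) / ε ^ 2)) one_pos
    have hm0 : 0 < massCoeff N δ := (le_max_left _ _).trans_lt hm
    have hm1 : 4 * b + 4 * C + 1 < massCoeff N δ * ε ^ 2 := by
      rw [← div_lt_iff₀ (by positivity)]
      exact (le_max_right _ _).trans_lt hm
    obtain ⟨n₀, hn₀⟩ := eventually_convForm_sub_le hN hΩm hΩ (measurable_farKer (N := N) δ)
      (abs_farKer_le hδ hδ1) (u := fun n => u (φ n)) (fun n => (hu _).le) hweak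
      (inv_pos.2 hcN)
    refine ⟨n₀, fun m hm n hn => ?_⟩
    have h1 := hn₀ m hm n hn
    set w : hSub Ω := u (φ m) - u (φ n) with hw
    set s : hSub Ω := u (φ m) + u (φ n) with hs
    have h2 : logBilin hN hΩm hΩ w w + logBilin hN hΩm hΩ s s =
        2 * logBilin hN hΩm hΩ (u (φ m)) (u (φ m)) +
        2 * logBilin hN hΩm hΩ (u (φ n)) (u (φ n)) := by
      simp only [hw, hs, map_add, map_sub, LinearMap.add_apply, LinearMap.sub_apply]
      ring
    have h3 : ‖toL2 hN hΩm hΩ s‖ ^ 2 ≤ 4 := by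
      have h4 : ‖toL2 hN hΩm hΩ s‖ ≤ 2 := by
        rw [hs, map_add]
        refine (norm_add_le _ _).trans ?_
        rw [hu, hu]; norm_num
      nlinarith [norm_nonneg (toL2 hN hΩm hΩ s)]
    have h5 := hC s
    have h6 : logBilin hN hΩm hΩ w w ≤ 4 * b + 4 * C := by
      nlinarith [hb' (φ m), hb' (φ n)]
    rw [logBilin_apply, logForm_split hN hΩm hΩ w.2 w.2 hδ hδ1, ← norm_toL2_sq hN hΩm hΩ] at h6
    have h7 : 0 ≤ cConst N / 2 * diffForm (radKer N (Set.Iic δ)) (w : Space N → ℝ) w :=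
      mul_nonneg (by positivity) (diffForm_self_nonneg _ _)
    have h8 : cConst N * convForm (farKer N δ) (w : Space N → ℝ) w ≤ 1 := by
      calc _ ≤ cConst N * (cConst N)⁻¹ := by gcongr
        _ = 1 := mul_inv_cancel₀ hcN.ne'
    have h9 : massCoeff N δ * ‖toL2 hN hΩm hΩ w‖ ^ 2 < massCoeff N δ * ε ^ 2 := by linarith
    have h10 := lt_of_mul_lt_mul_left h9 hm0.le
    rw [dist_eq_norm, ← map_sub]
    exact lt_of_pow_lt_pow_left₀ 2 hε.le h10
  obtain ⟨x, hx⟩ := cauchySeq_tendsto_of_complete hcauchy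
  obtain ⟨v, hv, hvc⟩ := exists_limit_mem_hSub hN hΩm hΩ (u := fun n => u (φ n)) (fun n => hu _)
    (hc.comp hφ.tendsto_atTop) hx
  exact ⟨φ, v, hφ, by rw [hv]; exact hx, hvc⟩

/-! ### Density, and infinite dimension of L² -/

lemma lipschitz_mem_hSpace (hN : 1 ≤ N) (hΩm : MeasurableSet Ω) (hΩ : Bornology.IsBounded Ω)
    {f : Space N → ℝ} {L : NNReal} (hf : LipschitzWith L f) (hf0 : ∀ x, x ∉ Ω → f x = 0) :
    f ∈ hSpace Ω := by
  have hfm : AEMeasurable f := hf.continuous.measurable.aemeasurable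
  have hF : Integrable (Ω.indicator fun _ : Space N => (L : ℝ) ^ 2) :=
    (integrable_indicator_iff hΩm).2 (integrableOn_const (hs := hΩ.measure_lt_top.ne))
  have hk := integrable_norm_mul_radKer hN
  have heven : ∀ z : Space N, ‖-z‖ * radKer N (Set.Iic 1) (-z) = ‖z‖ * radKer N (Set.Iic 1) z :=
    fun z => by rw [norm_neg, radKer_neg]
  refine mem_hSpace_iff.2 ⟨hfm, hf0, ?_⟩
  refine ((integrable_mul_conv_fst hF hk heven).add (integrable_mul_conv_snd hF hk)).mono'
    (aestronglyMeasurable_diff hfm hfm (measurable_radKer measurableSet_Iic))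
    (Eventually.of_forall fun p => ?_)
  rw [Real.norm_of_nonneg (mul_nonneg (mul_self_nonneg _) (radKer_nonneg _ _))]
  simp only [Pi.add_apply]
  rw [← add_mul, ← mul_assoc]
  by_cases h1 : ‖p.1 - p.2‖ ≤ 1
  · refine mul_le_mul_of_nonneg_right ?_ (radKer_nonneg _ _)
    have hL : |f p.1 - f p.2| ≤ L * ‖p.1 - p.2‖ := by
      simpa [Real.dist_eq, dist_eq_norm] using hf.dist_le_mul p.1 p.2
    have hsq : (f p.1 - f p.2) * (f p.1 - f p.2) ≤ (L : ℝ) ^ 2 * ‖p.1 - p.2‖ := by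
      calc (f p.1 - f p.2) * (f p.1 - f p.2) = |f p.1 - f p.2| ^ 2 := by rw [sq_abs, pow_two]
        _ ≤ (L * ‖p.1 - p.2‖) ^ 2 := by gcongr
        _ = (L : ℝ) ^ 2 * ‖p.1 - p.2‖ * ‖p.1 - p.2‖ := by ring
        _ ≤ (L : ℝ) ^ 2 * ‖p.1 - p.2‖ * 1 := by gcongr
        _ = _ := mul_one _
    have hi : ∀ x, 0 ≤ Ω.indicator (fun _ : Space N => (L : ℝ) ^ 2) x := fun x =>
      Set.indicator_nonneg (fun _ _ => sq_nonneg _) x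
    by_cases h2 : p.1 ∈ Ω
    · refine hsq.trans (mul_le_mul_of_nonneg_right ?_ (norm_nonneg _))
      rw [Set.indicator_of_mem h2]
      exact le_add_of_nonneg_right (hi _)
    · by_cases h3 : p.2 ∈ Ω
      · refine hsq.trans (mul_le_mul_of_nonneg_right ?_ (norm_nonneg _))
        rw [Set.indicator_of_mem h3]
        exact le_add_of_nonneg_left (hi _)
      · rw [hf0 _ h2, hf0 _ h3, sub_zero, mul_zero]
        exact mul_nonneg (add_nonneg (hi _) (hi _)) (norm_nonneg _)
  · rw [radKer_of_notMem (show _ ∉ Set.Iic (1 : ℝ) from h1), mul_zero, mul_zero]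

lemma denseRange_toL2 (hN : 1 ≤ N) (hΩo : IsOpen Ω) (hΩ : Bornology.IsBounded Ω) :
    DenseRange (toL2 hN hΩo.measurableSet hΩ) := by
  have hΩm := hΩo.measurableSet
  have : IsFiniteMeasure (volume.restrict Ω) := ⟨by
    rw [Measure.restrict_apply_univ]; exact hΩ.measure_lt_top⟩
  have hbot : (LinearMap.range (toL2 hN hΩm hΩ))ᗮ = ⊥ := by
    rw [Submodule.eq_bot_iff]
    intro g hg
    have hgi : IntegrableOn g Ω := (Lp.memLp g).integrable (by norm_num)
    have h0 : ∀ᵐ x, x ∈ Ω → g x = 0 := by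
      refine hΩo.ae_eq_zero_of_integral_contDiff_smul_eq_zero hgi.locallyIntegrableOn ?_
      intro ψ hψ hψc hψΩ
      have hψ0 : ∀ x, x ∉ Ω → ψ x = 0 := fun x hx =>
        image_eq_zero_of_notMem_tsupport fun h => hx (hψΩ h)
      obtain ⟨L, hL⟩ := ContDiff.lipschitzWith_of_hasCompactSupport hψc hψ (by simp)
      set w : hSub Ω := ⟨ψ, lipschitz_mem_hSpace hN hΩm hΩ hL hψ0⟩
      have h1 := hg (toL2 hN hΩm hΩ w) ⟨w, rfl⟩
      rw [L2.inner_def] at h1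
      rw [← h1, ← setIntegral_eq_integral_of_forall_compl_eq_zero (s := Ω)
        fun x hx => by rw [hψ0 x hx, zero_smul]]
      refine integral_congr_ae ?_
      filter_upwards [coeFn_toL2 hN hΩm hΩ w] with x hx
      rw [hx]
      simp [w, mul_comm]
    refine Lp.ext ?_
    filter_upwards [(ae_restrict_iff' hΩm).2 h0, Lp.coeFn_zero ℝ 2 (volume.restrict Ω)]
      with x h1 h2
    rw [h1, h2]
    rfl
  have htop := (Submodule.topologicalClosure_eq_top_iff).2 hbot
  exact Submodule.dense_iff_topologicalClosure_eq_top.2 htop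

/-- Indicator functions of disjoint annuli show that `L²(Ω)` is infinite dimensional. -/
lemma not_finiteDimensional_L2 (hN : 1 ≤ N) (hΩo : IsOpen Ω) (hΩ : Bornology.IsBounded Ω)
    (hne : Ω.Nonempty) : ¬ FiniteDimensional ℝ (Lp ℝ 2 (volume.restrict Ω)) := by
  have : NeZero N := ⟨by omega⟩
  have : Nontrivial (Space N) := inferInstance
  have : IsFiniteMeasure (volume.restrict Ω) := ⟨by
    rw [Measure.restrict_apply_univ]; exact hΩ.measure_lt_top⟩
  obtain ⟨x₀, hx₀⟩ := hne
  obtain ⟨r, hr, hball⟩ := Metric.isOpen_iff.1 hΩo x₀ hx₀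
  let A : ℕ → Set (Space N) := fun n =>
    {x | r / ((n + 1 : ℕ) + 1) < ‖x - x₀‖ ∧ ‖x - x₀‖ < r / (n + 1)}
  have hlt : ∀ n : ℕ, r / (((n + 1 : ℕ) : ℝ) + 1) < r / ((n : ℝ) + 1) := by
    intro n
    push_cast
    gcongr
    linarith
  have hc : Continuous fun x : Space N => ‖x - x₀‖ := by fun_prop
  have hAo : ∀ n, IsOpen (A n) := fun n =>
    (isOpen_lt continuous_const hc).inter (isOpen_lt hc continuous_const)
  have hAΩ : ∀ n, A n ⊆ Ω := by
    intro n x hx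
    refine hball (mem_ball_iff_norm.2 (hx.2.trans_le ?_))
    exact div_le_self hr.le (by linarith [(Nat.cast_nonneg n : (0 : ℝ) ≤ n)])
  have hAne : ∀ n, (A n).Nonempty := by
    intro n
    obtain ⟨s, hs1, hs2⟩ := exists_between (hlt n)
    obtain ⟨h, hh⟩ := exists_norm_eq (Space N) (c := s) (le_trans (by positivity) hs1.le)
    exact ⟨x₀ + h, by simp only [A, Set.mem_ofPred_eq, add_sub_cancel_left, hh]; exact ⟨hs1, hs2⟩⟩
  have hdisj : ∀ i j, i < j → A i ∩ A j = ∅ := by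
    intro i j hij
    rw [Set.eq_empty_iff_forall_notMem]
    rintro x ⟨h1, h2⟩
    have h3 : r / ((j : ℝ) + 1) ≤ r / (((i + 1 : ℕ) : ℝ) + 1) := by
      have : ((i + 1 : ℕ) : ℝ) ≤ j := by exact_mod_cast hij
      gcongr
    linarith [h1.1, h2.2]
  let e : ℕ → Lp ℝ 2 (volume.restrict Ω) := fun n =>
    indicatorConstLp 2 (hAo n).measurableSet (measure_ne_top _ _) 1
  have he : ∀ i j, inner ℝ (e i) (e j) = (volume.restrict Ω).real (A i ∩ A j) := fun i j =>
    L2.real_inner_indicatorConstLp_one_indicatorConstLp_one _ _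
  have hli : LinearIndependent ℝ e := by
    refine linearIndependent_of_ne_zero_of_inner_eq_zero (𝕜 := ℝ) ?_ ?_
    · intro i h0
      have h1 := he i i
      rw [h0, inner_zero_left, Set.inter_self, measureReal_restrict_apply (hAo i).measurableSet,
        Set.inter_eq_self_of_subset_left (hAΩ i)] at h1
      have h2 : 0 < volume (A i) := (hAo i).measure_pos _ (hAne i)
      have h3 : volume (A i) ≠ ∞ := (hΩ.subset (hAΩ i)).measure_lt_top.ne
      exact (ENNReal.toReal_pos h2.ne' h3).ne h1
    · intro i j hij
      rw [he]
      rcases lt_or_gt_of_ne hij with h | h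
      · rw [hdisj i j h]; simp
      · rw [Set.inter_comm, hdisj j i h]; simp
  intro hfin
  have := hli.finite_of_isNoetherian
  exact not_finite ℕ

/-! ### The strong maximum principle -/

lemma exists_setIntegral_pos_away (hN : 1 ≤ N) {v : Space N → ℝ} (hvi : Integrable v)
    (hv0 : ∀ x, 0 ≤ v x) (hne : ¬ v =ᵐ[volume] 0) (x₀ : Space N) :
    ∃ η > 0, 0 < ∫ y in {y | 2 * η < ‖y - x₀‖}, v y := by
  have : NeZero N := ⟨by omega⟩
  have : Nontrivial (Space N) := inferInstance
  by_contra! hcon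
  apply hne
  have h1 : ∀ n : ℕ, ∀ᵐ y, y ∈ {y : Space N | 2 * (1 / ((n : ℝ) + 1)) < ‖y - x₀‖} → v y = 0 := by
    intro n
    have hm : MeasurableSet {y : Space N | 2 * (1 / ((n : ℝ) + 1)) < ‖y - x₀‖} :=
      measurableSet_lt measurable_const (by fun_prop)
    have h2 := hcon (1 / ((n : ℝ) + 1)) (by positivity)
    have h3 := (setIntegral_eq_zero_iff_of_nonneg_ae (Eventually.of_forall hv0)
      hvi.integrableOn).1 (le_antisymm h2 (integral_nonneg hv0))
    exact (ae_restrict_iff' hm).1 h3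
  have h4 : ∀ᵐ y : Space N, y ≠ x₀ := by
    rw [ae_iff]
    simp
  filter_upwards [ae_all_iff.2 h1, h4] with y hy hyx
  obtain ⟨n, hn⟩ := exists_nat_one_div_lt (K := ℝ) (ε := ‖y - x₀‖ / 2)
    (half_pos (norm_pos_iff.2 (sub_ne_zero.2 hyx)))
  exact hy n (show 2 * (1 / ((n : ℝ) + 1)) < ‖y - x₀‖ by linarith)

lemma sub_mul_posPart_sub_nonneg (x y : ℝ) : 0 ≤ (x - y) * (max x 0 - max y 0) := by
  rcases le_total x y with h | h
  · exact mul_nonneg_of_nonpos_of_nonpos (sub_nonpos.2 h)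
      (sub_nonpos.2 (max_le_max_right 0 h))
  · exact mul_nonneg (sub_nonneg.2 h) (sub_nonneg.2 (max_le_max_right 0 h))

/-- Strong maximum principle: a nonnegative weak solution that does not vanish identically is
bounded below by a positive constant near every point of `Ω`. The solution is compared with a small
multiple `t f` of a Lipschitz bump `f`, by testing with `(t f - v)⁺`: the far part
of the kernel sees the mass of `v` away from the point and bounds `L_Δ v` from below there, whereas
`|L_Δ f|` is bounded because `|z|^{1-N}` is integrable near the origin. -/
lemma IsWeakSolution.exists_ball_le (hN : 1 ≤ N) (hΩo : IsOpen Ω) (hΩ : Bornology.IsBounded Ω)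
    {v : Space N → ℝ} {lam : ℝ} (hv : IsWeakSolution Ω lam v) (hv0 : ∀ x, 0 ≤ v x)
    (hne : ¬ v =ᵐ[volume] 0) {x₀ : Space N} (hx₀ : x₀ ∈ Ω) :
    ∃ r > 0, ∃ c > 0, ∀ᵐ y, y ∈ Metric.ball x₀ r → c ≤ v y := by
  have hΩm := hΩo.measurableSet
  have hcN := cConst_pos hN
  obtain ⟨hvΩ, hweak⟩ := hv
  have hv2 := memLp_two_of_mem_hSpace hN hΩm hΩ hvΩ
  have hvi := integrable_of_memLp_two hΩ hv2 hvΩ.2.1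
  obtain ⟨η, hη, hJ⟩ := exists_setIntegral_pos_away hN hvi hv0 hne x₀
  set A : Set (Space N) := {y | 2 * η < ‖y - x₀‖} with hA
  have hAm : MeasurableSet A := measurableSet_lt measurable_const (by fun_prop)
  set J := ∫ y in A, v y with hJdef
  obtain ⟨δ, hδ, hδ1, hδη, hm⟩ := exists_massCoeff_gt hN lam hη
  obtain ⟨r₁, hr₁, hball⟩ := Metric.isOpen_iff.1 hΩo x₀ hx₀
  obtain ⟨r, hr, hrr₁, hrη⟩ : ∃ r > 0, r ≤ r₁ ∧ r ≤ η :=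
    ⟨min r₁ η, lt_min hr₁ hη, min_le_left _ _, min_le_right _ _⟩
  obtain ⟨D, hD0, hD⟩ : ∃ D > 0, ∀ x ∈ Ω, ∀ y ∈ Ω, ‖x - y‖ ≤ D := by
    obtain ⟨C, hC⟩ := Metric.isBounded_iff.1 hΩ
    refine ⟨max C 1, lt_max_of_lt_right one_pos, fun x hx y hy => ?_⟩
    rw [← dist_eq_norm]
    exact (hC hx hy).trans (le_max_left _ _)
  set f : Space N → ℝ := fun y => max (r - ‖y - x₀‖) 0 with hf
  have hf0 : ∀ y, 0 ≤ f y := fun y => le_max_right _ _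
  have hfr : ∀ y, f y ≤ r := fun y => max_le (by linarith [norm_nonneg (y - x₀)]) hr.le
  have hfout : ∀ y, r ≤ ‖y - x₀‖ → f y = 0 := fun y hy => max_eq_right (by linarith)
  have hfdiff : ∀ x y, |f x - f y| ≤ ‖x - y‖ := by
    intro x y
    refine (abs_max_sub_max_le_abs _ _ _).trans ?_
    have h1 := abs_norm_sub_norm_le (y - x₀) (x - x₀)
    rw [sub_sub_sub_cancel_right, norm_sub_rev y x] at h1
    rwa [sub_sub_sub_cancel_left]
  have hfL : LipschitzWith 1 f := LipschitzWith.of_dist_le_mul fun x y => by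
    simpa [Real.dist_eq, dist_eq_norm] using hfdiff x y
  have hfΩ : f ∈ hSpace Ω := by
    refine lipschitz_mem_hSpace hN hΩm hΩ hfL fun y hy => hfout y ?_
    by_contra! h
    exact hy (hball (mem_ball_iff_norm.2 (h.trans_le hrr₁)))
  have hf2 := memLp_two_of_mem_hSpace hN hΩm hΩ hfΩ
  set κ := ∫ z : Space N, ‖z‖ * radKer N (Set.Iic 1) z with hκ
  have hκ0 : 0 ≤ κ := integral_nonneg fun z => mul_nonneg (norm_nonneg _) (radKer_nonneg _ _)
  set m := massCoeff N δ - lam with hmdef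
  have hm0 : 0 < m := sub_pos.2 hm
  set β := (D ^ N)⁻¹ * J with hβ
  have hβ0 : 0 < β := by positivity
  -- `t` is chosen so small that `t f` is a subsolution with respect to the lower bound `c_N β`
  set t := cConst N * β / (cConst N * κ + m * r) with ht
  have hden : 0 < cConst N * κ + m * r := by positivity
  have ht0 : 0 < t := by positivity
  set φ : Space N → ℝ := fun y => max (t * f y - v y) 0 with hφ
  have hφΩ : φ ∈ hSpace Ω :=
    posPart_mem_hSpace (mem_hSub.1 ((hSub Ω).sub_mem ((hSub Ω).smul_mem t hfΩ) hvΩ))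
  have hφ0 : ∀ y, 0 ≤ φ y := fun y => le_max_right _ _
  have hφball : ∀ y, φ y ≠ 0 → ‖y - x₀‖ < r := by
    intro y hy
    by_contra! h
    apply hy
    simp only [hφ, hfout y h, mul_zero, zero_sub]
    exact max_eq_right (neg_nonpos.2 (hv0 y))
  have hφ2 := memLp_two_of_mem_hSpace hN hΩm hΩ hφΩ
  have hφi := integrable_of_memLp_two hΩ hφ2 hφΩ.2.1
  set P := ∫ y, φ y with hP
  have hP0 : 0 ≤ P := integral_nonneg hφ0
  have hconv : β * P ≤ convForm (farKer N δ) v φ := by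
    have h1 : β * P = ∫ p : Space N × Space N, (D ^ N)⁻¹ * (A.indicator v p.1 * φ p.2)
        ∂(volume.prod volume) := by
      rw [integral_const_mul, integral_prod_mul, integral_indicator hAm, hβ, mul_assoc]
    rw [h1, convForm]
    refine integral_mono (((hvi.indicator hAm).mul_prod hφi).const_mul _)
      (integrable_convForm hvi hφi (measurable_farKer δ) (abs_farKer_le hδ hδ1)) fun p => ?_
    simp only
    by_cases h2 : p.1 ∈ A
    · rw [Set.indicator_of_mem h2, mul_comm]
      by_cases h3 : v p.1 = 0
      · simp [h3]
      by_cases h4 : φ p.2 = 0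
      · simp [h4]
      refine mul_le_mul_of_nonneg_left ?_ (mul_nonneg (hv0 _) (hφ0 _))
      have h5 := hφball _ h4
      have h6 : p.1 ∈ Ω := by
        by_contra h
        exact h3 (hvΩ.2.1 _ h)
      have h7 : p.2 ∈ Ω := by
        by_contra h
        exact h4 (hφΩ.2.1 _ h)
      refine inv_pow_le_farKer hδ.le ?_ (hD _ h6 _ h7)
      have h8 : ‖p.1 - x₀‖ ≤ ‖p.1 - p.2‖ + ‖p.2 - x₀‖ := norm_sub_le_norm_sub_add_norm_sub _ _ _
      have h9 : 2 * η < ‖p.1 - x₀‖ := h2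
      linarith
    · rw [Set.indicator_of_notMem h2, zero_mul, mul_zero]
      exact mul_nonneg (mul_nonneg (hv0 _) (hφ0 _)) (farKer_nonneg _ _)
  have hdf : diffForm (radKer N (Set.Iic δ)) f φ ≤ 2 * (P * κ) := by
    have hk := integrable_norm_mul_radKer hN
    have heven : ∀ z : Space N,
        ‖-z‖ * radKer N (Set.Iic 1) (-z) = ‖z‖ * radKer N (Set.Iic 1) z :=
      fun z => by rw [norm_neg, radKer_neg]
    rw [two_mul]
    conv_rhs => lhs; rw [hP, hκ, ← integral_mul_conv_fst hφi hk heven]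
    conv_rhs => rhs; rw [hP, hκ, ← integral_mul_conv_snd hφi hk]
    rw [← integral_add (integrable_mul_conv_fst hφi hk heven) (integrable_mul_conv_snd hφi hk)]
    refine integral_mono (integrable_diffForm_Iic hfΩ hφΩ hδ1)
      ((integrable_mul_conv_fst hφi hk heven).add (integrable_mul_conv_snd hφi hk)) fun p => ?_
    simp only
    rw [← add_mul, ← mul_assoc]
    have h1 : radKer N (Set.Iic δ) (p.1 - p.2) ≤ radKer N (Set.Iic 1) (p.1 - p.2) := by
      rw [radKer_Iic_eq_add hδ1]
      exact le_add_of_nonneg_right (radKer_nonneg _ _)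
    have h2 : (f p.1 - f p.2) * (φ p.1 - φ p.2) ≤ (φ p.1 + φ p.2) * ‖p.1 - p.2‖ := by
      refine (le_abs_self _).trans ?_
      rw [abs_mul, mul_comm]
      refine mul_le_mul ?_ (hfdiff _ _) (abs_nonneg _) (add_nonneg (hφ0 _) (hφ0 _))
      rw [abs_le]
      constructor <;> linarith [hφ0 p.1, hφ0 p.2]
    exact mul_le_mul h2 h1 (radKer_nonneg _ _)
      (mul_nonneg (add_nonneg (hφ0 _) (hφ0 _)) (norm_nonneg _))
  have hdv : diffForm (radKer N (Set.Iic δ)) v φ ≤ t * diffForm (radKer N (Set.Iic δ)) f φ := by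
    rw [diffForm, diffForm, ← integral_const_mul]
    refine integral_mono (integrable_diffForm_Iic hvΩ hφΩ hδ1)
      ((integrable_diffForm_Iic hfΩ hφΩ hδ1).const_mul t) fun p => ?_
    simp only
    rw [← mul_assoc]
    refine mul_le_mul_of_nonneg_right ?_ (radKer_nonneg _ _)
    have h1 := sub_mul_posPart_sub_nonneg (t * f p.1 - v p.1) (t * f p.2 - v p.2)
    have h2 : t * (f p.1 - f p.2) * (φ p.1 - φ p.2) - (v p.1 - v p.2) * (φ p.1 - φ p.2) =
        (t * f p.1 - v p.1 - (t * f p.2 - v p.2)) *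
          (max (t * f p.1 - v p.1) 0 - max (t * f p.2 - v p.2) 0) := by
      simp only [hφ]
      ring
    linarith
  have hvφ : Integrable fun x => v x * φ x := hv2.integrable_mul hφ2
  have hfφ : Integrable fun x => f x * φ x := hf2.integrable_mul hφ2
  have hφφ : Integrable fun x => φ x * φ x := hφ2.integrable_mul hφ2
  have hmass : ∫ x, v x * φ x = t * (∫ x, f x * φ x) - ∫ x, φ x * φ x := by
    rw [← integral_const_mul, ← integral_sub (hfφ.const_mul t) hφφ]
    congr 1
    ext x
    simp only [hφ]
    rcases max_cases (t * f x - v x) 0 with h1 | h1 <;> rw [h1.1] <;> ring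
  have hfP : ∫ x, f x * φ x ≤ r * P := by
    rw [hP, ← integral_const_mul]
    exact integral_mono hfφ (hφi.const_mul r) fun x =>
      mul_le_mul_of_nonneg_right (hfr x) (hφ0 x)
  have hw := hweak φ hφΩ
  rw [setIntegral_mul_eq hvΩ.2.1, logForm_split hN hΩm hΩ hvΩ hφΩ hδ hδ1] at hw
  have hzero : ∫ x, φ x * φ x = 0 := by
    refine le_antisymm ?_ (integral_nonneg fun x => mul_self_nonneg _)
    have e1 : cConst N / 2 * diffForm (radKer N (Set.Iic δ)) v φ ≤
        cConst N / 2 * (t * (2 * (P * κ))) := by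
      refine mul_le_mul_of_nonneg_left (hdv.trans ?_) (by positivity)
      exact mul_le_mul_of_nonneg_left hdf ht0.le
    have e2 : m * (t * ∫ x, f x * φ x) ≤ m * (t * (r * P)) := by gcongr
    have e3 := mul_le_mul_of_nonneg_left hconv hcN.le
    have e4 : t * (cConst N * κ + m * r) = cConst N * β := by
      rw [ht]; field_simp
    have e5 : cConst N / 2 * (t * (2 * (P * κ))) + m * (t * (r * P)) = cConst N * (β * P) := by
      rw [← mul_assoc (cConst N), ← e4]
      ring
    have e6 : m * (∫ x, v x * φ x) =
        massCoeff N δ * (∫ x, v x * φ x) - lam * ∫ x, v x * φ x := by rw [hmdef]; ring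
    have e7 : m * (∫ x, v x * φ x) = m * (t * ∫ x, f x * φ x) - m * ∫ x, φ x * φ x := by
      rw [hmass]; ring
    have e8 : m * ∫ x, φ x * φ x ≤ 0 := by linarith
    exact nonpos_of_mul_nonpos_right e8 hm0
  rw [integral_eq_zero_iff_of_nonneg (fun x => mul_self_nonneg _) hφφ] at hzero
  refine ⟨r / 2, half_pos hr, t * (r / 2), by positivity, ?_⟩
  filter_upwards [hzero] with y hy hyb
  have h1 : φ y = 0 := mul_self_eq_zero.1 hy
  have h2 : t * f y - v y ≤ 0 := (le_max_left _ _).trans h1.le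
  have h3 : r / 2 ≤ f y := by
    rw [mem_ball_iff_norm] at hyb
    exact le_max_of_le_left (by linarith)
  have h4 : t * (r / 2) ≤ t * f y := by gcongr
  linarith

/-! ### The lowest eigenvalue -/

/-- A function that is locally essentially bounded below by positive constants can be changed on a
null set so that these bounds hold everywhere. -/
lemma exists_positive_representative {v : Space N → ℝ} (hv0 : ∀ x, x ∉ Ω → v x = 0)
    (hloc : ∀ x ∈ Ω, ∃ r > 0, ∃ c > 0, ∀ᵐ y, y ∈ Metric.ball x r → c ≤ v y) :
    ∃ w : Space N → ℝ, w =ᵐ[volume] v ∧ (∀ x, x ∉ Ω → w x = 0) ∧ (∀ x ∈ Ω, 0 < w x) ∧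
      ∀ K ⊆ Ω, IsCompact K → ∃ c : ℝ, 0 < c ∧ ∀ x ∈ K, c ≤ w x := by
  classical
  have hloc' : ∀ x, ∃ r, ∃ c, 0 < c ∧ (x ∈ Ω → 0 < r ∧ ∀ᵐ y, y ∈ Metric.ball x r → c ≤ v y) := by
    intro x
    by_cases hx : x ∈ Ω
    · obtain ⟨r, hr, c, hc, h⟩ := hloc x hx
      exact ⟨r, c, hc, fun _ => ⟨hr, h⟩⟩
    · exact ⟨1, 1, one_pos, fun h => absurd h hx⟩
  choose r c hc hrc using hloc'
  obtain ⟨t, htΩ, htc, hcover⟩ := TopologicalSpace.countable_cover_nhdsWithin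
    (s := Ω) (f := fun x => Metric.ball x (r x)) fun x hx =>
      mem_nhdsWithin_of_mem_nhds (Metric.ball_mem_nhds x (hrc x hx).1)
  have hgood : ∀ᵐ y, ∀ x ∈ t, y ∈ Metric.ball x (r x) → c x ≤ v y :=
    (ae_ball_iff htc).2 fun x hx => (hrc x (htΩ hx)).2
  set G : Set (Space N) := {y | ∀ x ∈ t, y ∈ Metric.ball x (r x) → c x ≤ v y} with hG
  set w : Space N → ℝ := fun y => if y ∈ Ω ∧ y ∉ G then 1 else v y with hw
  have hlow : ∀ y ∈ Ω, ∀ x ∈ t, y ∈ Metric.ball x (r x) → min (c x) 1 ≤ w y := by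
    intro y hy x hx hyx
    by_cases hyG : y ∈ G
    · simp only [hw, hyG, not_true, and_false, if_false]
      exact (min_le_left _ _).trans (hyG x hx hyx)
    · simp only [hw, hy, hyG, not_false_iff, and_self, if_true]
      exact min_le_right _ _
  refine ⟨w, ?_, ?_, ?_, ?_⟩
  · filter_upwards [hgood] with y hy
    have : y ∈ G := hy
    simp [hw, this]
  · intro y hy
    simp [hw, hy, hv0 y hy]
  · intro y hy
    obtain ⟨x, hx, hyx⟩ := Set.mem_iUnion₂.1 (hcover hy)
    exact (lt_min (hc x) one_pos).trans_le (hlow y hy x hx hyx)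
  · intro K hK hKc
    obtain ⟨b, hbt, hbf, hb⟩ := hKc.elim_finite_subcover_image (b := t)
      (c := fun x => Metric.ball x (r x)) (fun x _ => Metric.isOpen_ball) (hK.trans hcover)
    have hmin : ∃ ε : ℝ, 0 < ε ∧ ∀ x ∈ b, ε ≤ min (c x) 1 := by
      rcases b.eq_empty_or_nonempty with h | h
      · exact ⟨1, one_pos, by simp [h]⟩
      · obtain ⟨x, hx, hxm⟩ := hbf.exists_minimalFor (fun x => min (c x) 1) b h
        exact ⟨min (c x) 1, lt_min (hc x) one_pos, fun y hy =>
          (le_total _ _).elim id fun h => hxm hy h⟩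
    obtain ⟨ε, hε, hεb⟩ := hmin
    refine ⟨ε, hε, fun y hy => ?_⟩
    obtain ⟨x, hx, hyx⟩ := Set.mem_iUnion₂.1 (hb hy)
    exact (hεb x hx).trans (hlow y (hK hy) x (hbt hx) hyx)

lemma ae_prod_of_ae_eq {u w : Space N → ℝ} (h : u =ᵐ[volume] w) :
    ∀ᵐ p : Space N × Space N ∂(volume.prod volume), u p.1 = w p.1 ∧ u p.2 = w p.2 :=
  (Measure.quasiMeasurePreserving_fst.ae h).and (Measure.quasiMeasurePreserving_snd.ae h)

lemma mem_hSpace_congr {u w : Space N → ℝ} (hu : u ∈ hSpace Ω) (h : w =ᵐ[volume] u)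
    (hw0 : ∀ x, x ∉ Ω → w x = 0) : w ∈ hSpace Ω := by
  obtain ⟨hu1, -, hu3⟩ := mem_hSpace_iff.1 hu
  refine mem_hSpace_iff.2 ⟨hu1.congr h.symm, hw0, hu3.congr ?_⟩
  filter_upwards [ae_prod_of_ae_eq h] with p hp
  rw [hp.1, hp.2]

lemma logForm_congr_left {u u' : Space N → ℝ} (h : u =ᵐ[volume] u') (w : Space N → ℝ) :
    logForm u w = logForm u' w := by
  have h1 : diffForm (radKer N (Set.Iic 1)) u w = diffForm (radKer N (Set.Iic 1)) u' w := by
    refine integral_congr_ae ?_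
    filter_upwards [ae_prod_of_ae_eq h] with p hp
    rw [hp.1, hp.2]
  have h2 : convForm (radKer N (Set.Ici 1)) u w = convForm (radKer N (Set.Ici 1)) u' w := by
    refine integral_congr_ae ?_
    filter_upwards [ae_prod_of_ae_eq h] with p hp
    rw [hp.1]
  have h3 : ∫ x, u x * w x = ∫ x, u' x * w x := by
    refine integral_congr_ae ?_
    filter_upwards [h] with x hx
    rw [hx]
  rw [logForm_eq, logForm_eq, h1, h2, h3]

/-- Replacing `u` by `|u|` does not increase the form: differences shrink, and the far interaction,
which enters with a negative sign, grows. -/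
lemma logForm_abs_le (hN : 1 ≤ N) (hΩm : MeasurableSet Ω) (hΩ : Bornology.IsBounded Ω)
    {u : Space N → ℝ} (hu : u ∈ hSpace Ω) :
    logForm (fun x => |u x|) (fun x => |u x|) ≤ logForm u u := by
  have hcN := cConst_pos hN
  have hui := integrable_of_memLp_two hΩ (memLp_two_of_mem_hSpace hN hΩm hΩ hu) hu.2.1
  have ha := abs_mem_hSpace hu
  have h1 : diffForm (radKer N (Set.Iic 1)) (fun x => |u x|) (fun x => |u x|) ≤
      diffForm (radKer N (Set.Iic 1)) u u := by
    refine integral_mono (integrable_diffForm_Iic ha ha le_rfl)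
      (integrable_diffForm_Iic hu hu le_rfl) fun p => ?_
    refine mul_le_mul_of_nonneg_right ?_ (radKer_nonneg _ _)
    rw [← pow_two, ← pow_two, sq_le_sq]
    exact abs_abs_sub_abs_le _ _
  have h2 : convForm (radKer N (Set.Ici 1)) u u ≤
      convForm (radKer N (Set.Ici 1)) (fun x => |u x|) (fun x => |u x|) := by
    have hk := measurable_radKer (N := N) (I := Set.Ici 1) measurableSet_Ici
    have hb := abs_radKer_le (N := N) (I := Set.Ici 1) one_pos le_rfl
    refine integral_mono (integrable_convForm hui hui hk hb)
      (integrable_convForm hui.abs hui.abs hk hb) fun p => ?_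
    refine mul_le_mul_of_nonneg_right ?_ (radKer_nonneg _ _)
    rw [← abs_mul]
    exact le_abs_self _
  rw [logForm_eq, logForm_eq]
  simp only [abs_mul_abs_self]
  gcongr

lemma isWeakSolution_coe_iff (hN : 1 ≤ N) (hΩ : Bornology.IsBounded Ω)
    (hΩm : MeasurableSet Ω) {lam : ℝ} {u : hSub Ω} :
    IsWeakSolution Ω lam (u : Space N → ℝ) ↔ ∀ v, logBilin hN hΩm hΩ u v =
      lam * inner ℝ (toL2 hN hΩm hΩ u) (toL2 hN hΩm hΩ v) := by
  simp only [inner_toL2, logBilin_apply]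
  constructor
  · intro h v
    rw [h.2 v v.2, setIntegral_mul_eq u.2.2.1]
  · intro h
    refine ⟨u.2, fun φ hφ => ?_⟩
    rw [setIntegral_mul_eq u.2.2.1]
    exact h ⟨φ, hφ⟩

/-- The absolute value of `u` as an element of `ℍ(Ω)`. -/
def absSub (u : hSub Ω) : hSub Ω := ⟨fun x => |(u : Space N → ℝ) x|, abs_mem_hSpace u.2⟩

lemma norm_toL2_absSub (hN : 1 ≤ N) (hΩ : Bornology.IsBounded Ω)
    (hΩm : MeasurableSet Ω) (u : hSub Ω) :
    ‖toL2 hN hΩm hΩ (absSub u)‖ = ‖toL2 hN hΩm hΩ u‖ := by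
  rw [← sq_eq_sq₀ (norm_nonneg _) (norm_nonneg _), norm_toL2_sq, norm_toL2_sq]
  simp only [absSub, abs_mul_abs_self]

/-- If the form is bounded below by `μ` times the `L²` norm, equality is inherited by the absolute
value, so that the absolute value of an eigenfunction for `μ` is again one. -/
lemma isWeakSolution_absSub (hN : 1 ≤ N) (hΩ : Bornology.IsBounded Ω)
    (hΩm : MeasurableSet Ω) {μ : ℝ}
    (hmin : ∀ v, μ * ‖toL2 hN hΩm hΩ v‖ ^ 2 ≤ logBilin hN hΩm hΩ v v) {u : hSub Ω}
    (hu : logBilin hN hΩm hΩ u u = μ * ‖toL2 hN hΩm hΩ u‖ ^ 2) :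
    IsWeakSolution Ω μ (absSub u : Space N → ℝ) := by
  rw [isWeakSolution_coe_iff hN hΩ hΩm]
  intro v
  have h1 : logBilin hN hΩm hΩ (absSub u) (absSub u) =
      μ * ‖toL2 hN hΩm hΩ (absSub u)‖ ^ 2 := by
    refine le_antisymm ?_ (hmin _)
    rw [norm_toL2_absSub, ← hu]
    exact logForm_abs_le hN hΩm hΩ u.2
  exact IsFormMinimizer.form_eq (S := ∅) (fun u v => logForm_comm _ _) (fun v _ => hmin v)
    (by simp) h1 (by simp)

lemma IsWeakSolution.add (hN : 1 ≤ N) (hΩ : Bornology.IsBounded Ω)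
    (hΩm : MeasurableSet Ω) {lam : ℝ} {u v : hSub Ω}
    (hu : IsWeakSolution Ω lam (u : Space N → ℝ)) (hv : IsWeakSolution Ω lam (v : Space N → ℝ)) :
    IsWeakSolution Ω lam ((u + v : hSub Ω) : Space N → ℝ) := by
  rw [isWeakSolution_coe_iff hN hΩ hΩm] at hu hv ⊢
  intro w
  rw [map_add, map_add, LinearMap.add_apply, inner_add_left, hu, hv]
  ring

lemma IsWeakSolution.smul (hN : 1 ≤ N) (hΩ : Bornology.IsBounded Ω)
    (hΩm : MeasurableSet Ω) {lam : ℝ} {u : hSub Ω} (c : ℝ)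
    (hu : IsWeakSolution Ω lam (u : Space N → ℝ)) :
    IsWeakSolution Ω lam ((c • u : hSub Ω) : Space N → ℝ) := by
  rw [isWeakSolution_coe_iff hN hΩ hΩm] at hu ⊢
  intro w
  rw [map_smul, map_smul, LinearMap.smul_apply, real_inner_smul_left, hu, smul_eq_mul]
  ring

lemma IsWeakSolution.ae_pos (hN : 1 ≤ N) (hΩo : IsOpen Ω)
    (hΩ : Bornology.IsBounded Ω) {lam : ℝ} {v : Space N → ℝ} (hv : IsWeakSolution Ω lam v)
    (hv0 : ∀ x, 0 ≤ v x) (hne : ¬ v =ᵐ[volume] 0) : ∀ᵐ x, x ∈ Ω → 0 < v x := by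
  obtain ⟨w, hwv, -, hw, -⟩ := exists_positive_representative hv.1.2.1
    fun x hx => hv.exists_ball_le hN hΩo hΩ hv0 hne hx
  filter_upwards [hwv] with x hx hxΩ
  rw [← hx]
  exact hw x hxΩ

/-- A solution for the lowest eigenvalue that is orthogonal to a positive function is nonpositive:
its positive part is a solution too, hence zero or positive throughout `Ω`. -/
lemma ae_nonpos_of_orthogonal (hN : 1 ≤ N) (hΩo : IsOpen Ω)
    (hΩ : Bornology.IsBounded Ω) (hne : Ω.Nonempty) {μ : ℝ}
    (hmin : ∀ v, μ * ‖toL2 hN hΩo.measurableSet hΩ v‖ ^ 2 ≤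
      logBilin hN hΩo.measurableSet hΩ v v)
    {e z : hSub Ω} (he : ∀ x ∈ Ω, 0 < (e : Space N → ℝ) x)
    (hz : IsWeakSolution Ω μ (z : Space N → ℝ))
    (horth : inner ℝ (toL2 hN hΩo.measurableSet hΩ z) (toL2 hN hΩo.measurableSet hΩ e) = 0) :
    ∀ᵐ x, (z : Space N → ℝ) x ≤ 0 := by
  have hΩm := hΩo.measurableSet
  have hzz : logBilin hN hΩm hΩ z z = μ * ‖toL2 hN hΩm hΩ z‖ ^ 2 := by
    rw [(isWeakSolution_coe_iff hN hΩ hΩm).1 hz z, real_inner_self_eq_norm_sq]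
  have hp := (isWeakSolution_absSub hN hΩ hΩm hmin hzz).add hN hΩ hΩm hz
  set p : hSub Ω := absSub z + z with hpdef
  have hpx : ∀ x, (p : Space N → ℝ) x = |(z : Space N → ℝ) x| + (z : Space N → ℝ) x :=
    fun x => rfl
  have hp0 : ∀ x, 0 ≤ (p : Space N → ℝ) x := fun x => by
    rw [hpx]
    linarith [neg_abs_le ((z : Space N → ℝ) x)]
  by_cases hpz : (p : Space N → ℝ) =ᵐ[volume] 0
  · filter_upwards [hpz] with x hx
    rw [hpx, Pi.zero_apply] at hx
    linarith [abs_nonneg ((z : Space N → ℝ) x)]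
  exfalso
  have hzpos : ∀ᵐ x, x ∈ Ω → 0 < (z : Space N → ℝ) x := by
    filter_upwards [hp.ae_pos hN hΩo hΩ hp0 hpz] with x hx hxΩ
    have h1 := hx hxΩ
    rw [hpx] at h1
    by_contra! h2
    rw [abs_of_nonpos h2] at h1
    linarith
  rw [inner_toL2] at horth
  have hint : Integrable fun x => (z : Space N → ℝ) x * (e : Space N → ℝ) x :=
    (memLp_two_of_mem_hSpace hN hΩm hΩ z.2).integrable_mul
      (memLp_two_of_mem_hSpace hN hΩm hΩ e.2)
  rw [integral_eq_zero_iff_of_nonneg_ae ?_ hint] at horth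
  · have hnull : volume Ω = 0 := by
      have : ∀ᵐ x : Space N, x ∉ Ω := by
        filter_upwards [horth, hzpos] with x h1 h2 hx
        exact (mul_pos (h2 hx) (he x hx)).ne' h1
      simpa [ae_iff] using this
    exact (hΩo.measure_pos volume hne).ne' hnull
  · filter_upwards [hzpos] with x hx
    by_cases hxΩ : x ∈ Ω
    · exact (mul_pos (hx hxΩ) (he x hxΩ)).le
    · simp [z.2.2.1 x hxΩ]

lemma ae_eq_zero_of_orthogonal (hN : 1 ≤ N) (hΩo : IsOpen Ω)
    (hΩ : Bornology.IsBounded Ω) (hne : Ω.Nonempty) {μ : ℝ}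
    (hmin : ∀ v, μ * ‖toL2 hN hΩo.measurableSet hΩ v‖ ^ 2 ≤
      logBilin hN hΩo.measurableSet hΩ v v)
    {e z : hSub Ω} (he : ∀ x ∈ Ω, 0 < (e : Space N → ℝ) x)
    (hz : IsWeakSolution Ω μ (z : Space N → ℝ))
    (horth : inner ℝ (toL2 hN hΩo.measurableSet hΩ z) (toL2 hN hΩo.measurableSet hΩ e) = 0) :
    (z : Space N → ℝ) =ᵐ[volume] 0 := by
  have h1 := ae_nonpos_of_orthogonal hN hΩo hΩ hne hmin he hz horth
  have h2 := ae_nonpos_of_orthogonal hN hΩo hΩ hne hmin he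
    (hz.smul hN hΩ hΩo.measurableSet (-1)) (by
      rw [map_smul, real_inner_smul_left, horth, mul_zero])
  filter_upwards [h1, h2] with x hx1 hx2
  have h3 : ((-1 : ℝ) • z : hSub Ω).1 x = -(z : Space N → ℝ) x := by simp
  rw [h3] at hx2
  exact le_antisymm hx1 (neg_nonpos.1 hx2)

/-- There is a minimiser of the form on the `L²` unit sphere that is positive in `Ω`,
locally uniformly. -/
lemma exists_positive_formMinimizer (hN : 1 ≤ N) (hΩo : IsOpen Ω)
    (hΩ : Bornology.IsBounded Ω) (hne : Ω.Nonempty) :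
    ∃ e : hSub Ω, IsFormMinimizer (toL2 hN hΩo.measurableSet hΩ)
      (logBilin hN hΩo.measurableSet hΩ) ∅ e ∧ (∀ x ∈ Ω, 0 < (e : Space N → ℝ) x) ∧
      ∀ K ⊆ Ω, IsCompact K → ∃ c : ℝ, 0 < c ∧ ∀ x ∈ K, c ≤ (e : Space N → ℝ) x := by
  have hΩm := hΩo.measurableSet
  obtain ⟨C, -, hC⟩ := exists_logBilin_ge hN hΩm hΩ
  obtain ⟨e, he1, -, hmin⟩ := exists_formMinimizer hC (formCompact_logBilin hN hΩm hΩ)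
    (denseRange_toL2 hN hΩo hΩ) (not_finiteDimensional_L2 hN hΩo hΩ hne) Set.finite_empty
  have hmin' := fun v => hmin v (by simp)
  have habs := isWeakSolution_absSub hN hΩ hΩm hmin' (u := e) (by rw [he1]; ring)
  have habs0 : ¬ (absSub e : Space N → ℝ) =ᵐ[volume] 0 := by
    intro h
    have h1 := norm_toL2_absSub hN hΩ hΩm e
    have h2 := norm_toL2_sq hN hΩm hΩ (absSub e)
    rw [h1, he1] at h2
    have h3 : ∫ x, (absSub e : Space N → ℝ) x * (absSub e : Space N → ℝ) x = 0 := by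
      refine integral_eq_zero_of_ae ?_
      filter_upwards [h] with x hx
      rw [hx]
      simp
    rw [h3] at h2
    norm_num at h2
  obtain ⟨w, hw, hw0, hwpos, hwK⟩ := exists_positive_representative habs.1.2.1
    fun x hx => habs.exists_ball_le hN hΩo hΩ (fun _ => abs_nonneg _) habs0 hx
  have hwΩ := mem_hSpace_congr habs.1 hw hw0
  have hform : logForm w w = logForm (e : Space N → ℝ) e := by
    have h1 : logForm w w = logBilin hN hΩm hΩ (absSub e) (absSub e) := by
      rw [logForm_congr_left hw, logForm_comm, logForm_congr_left hw]
      rfl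
    rw [h1, (isWeakSolution_coe_iff hN hΩ hΩm).1 habs, real_inner_self_eq_norm_sq,
      norm_toL2_absSub, he1]
    simp
  have hL : toL2 hN hΩm hΩ ⟨w, hwΩ⟩ = toL2 hN hΩm hΩ (absSub e) := by
    refine Lp.ext ?_
    filter_upwards [coeFn_toL2 hN hΩm hΩ ⟨w, hwΩ⟩, coeFn_toL2 hN hΩm hΩ (absSub e),
      ae_restrict_of_ae hw] with x h1 h2 h3
    rw [h1, h2]
    exact h3
  refine ⟨⟨w, hwΩ⟩, ⟨?_, by simp, fun v _ => ?_⟩, hwpos, hwK⟩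
  · rw [hL, norm_toL2_absSub, he1]
  · rw [logBilin_apply]
    refine le_trans (le_of_eq ?_) (hmin' v)
    rw [hform, logBilin_apply]

lemma norm_toL2_eq_one_iff (hN : 1 ≤ N) (hΩm : MeasurableSet Ω) (hΩ : Bornology.IsBounded Ω)
    (u : hSub Ω) : ‖toL2 hN hΩm hΩ u‖ = 1 ↔
      eLpNorm (u : Space N → ℝ) 2 (volume.restrict Ω) = 1 := by
  rw [← ENNReal.toReal_eq_one_iff]
  change ‖((memLp_two_of_mem_hSpace hN hΩm hΩ u.2).restrict Ω).toLp (u : Space N → ℝ)‖ = 1 ↔ _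
  rw [Lp.norm_toLp]

end LogLaplacian

/-- The sequences are indexed from `0`: `lam k` and `ξ k` are the `(k+1)`-st eigenvalue and
eigenfunction. -/
theorem theorem1p3 (N : ℕ) (hN : 1 ≤ N) (Ω : Set (LogLaplacian.Space N))
    (hΩ_open : IsOpen Ω) (hΩ_conn : IsConnected Ω) (hΩ_bdd : Bornology.IsBounded Ω) :
    ∃ (lam : ℕ → ℝ) (ξ : ℕ → LogLaplacian.Space N → ℝ),
      (∀ k, LogLaplacian.IsEigenfunction Ω (lam k) (ξ k)) ∧
      lam 0 < lam 1 ∧ Monotone lam ∧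
      -- (i) the min-characterization
      (∀ k, IsLeast
        {t : ℝ | ∃ u ∈ LogLaplacian.hOrth Ω ξ k,
          eLpNorm u 2 (volume.restrict Ω) = 1 ∧ LogLaplacian.logForm u u = t} (lam k)) ∧
      -- (ii) orthonormal basis of `L²(Ω)`
      (∃ b : HilbertBasis ℕ ℝ (Lp ℝ 2 (volume.restrict Ω)),
        ∀ k, (b k : LogLaplacian.Space N → ℝ) =ᵐ[volume.restrict Ω] ξ k) ∧
      -- (iii) strict positivity, also locally uniformly, and simplicity
      (∀ x ∈ Ω, 0 < ξ 0 x) ∧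
      (∀ K ⊆ Ω, IsCompact K → ∃ c : ℝ, 0 < c ∧ ∀ x ∈ K, c ≤ ξ 0 x) ∧
      (∀ u, LogLaplacian.IsWeakSolution Ω (lam 0) u → ∃ t : ℝ, u =ᵐ[volume] fun x => t * ξ 0 x) ∧
      -- (iv) divergence of the eigenvalues
      Tendsto lam atTop atTop := by

  have hΩm := hΩ_open.measurableSet
  have hne := hΩ_conn.nonempty
  obtain ⟨C, -, hC⟩ := LogLaplacian.exists_logBilin_ge hN hΩm hΩ_bdd
  obtain ⟨e, he, hepos, heK⟩ :=
    LogLaplacian.exists_positive_formMinimizer hN hΩ_open hΩ_bdd hne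
  obtain ⟨lam, ξ, hξ0, hmono, hON, hval, hmin, heq, hlim, hspan⟩ :=
    LogLaplacian.exists_formEigenbasis (fun u v => LogLaplacian.logForm_comm _ _) hC
      (LogLaplacian.formCompact_logBilin hN hΩm hΩ_bdd)
      (LogLaplacian.denseRange_toL2 hN hΩ_open hΩ_bdd)
      (LogLaplacian.not_finiteDimensional_L2 hN hΩ_open hΩ_bdd hne) he
  have hinner := LogLaplacian.inner_toL2 hN hΩm hΩ_bdd
  have hweak : ∀ k, LogLaplacian.IsWeakSolution Ω (lam k) (ξ k : LogLaplacian.Space N → ℝ) :=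
    fun k => (LogLaplacian.isWeakSolution_coe_iff hN hΩ_bdd hΩm).2 (heq k)
  have hmin0 := fun v => hmin 0 v (by simp)
  have hξ0pos : ∀ x ∈ Ω, 0 < (ξ 0 : LogLaplacian.Space N → ℝ) x := by rwa [hξ0]
  have hnz : ∀ k, ¬ ((ξ k : LogLaplacian.Space N → ℝ) =ᵐ[volume] 0) := by
    intro k h
    have h1 := LogLaplacian.norm_toL2_sq hN hΩm hΩ_bdd (ξ k)
    have h2 : ∫ x, (ξ k : LogLaplacian.Space N → ℝ) x * (ξ k : LogLaplacian.Space N → ℝ) x = 0 := by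
      refine integral_eq_zero_of_ae ?_
      filter_upwards [h] with x hx
      rw [hx]
      simp
    rw [hON.1 k, h2] at h1
    norm_num at h1
  refine ⟨lam, fun k => ξ k, fun k => ⟨hweak k, hnz k⟩, ?_, hmono, fun k => ⟨?_, ?_⟩, ?_, hξ0pos,
    fun K hK hKc => by simpa only [hξ0] using heK K hK hKc, ?_, hlim⟩
  · refine lt_of_le_of_ne (hmono zero_le_one) fun h => hnz 1 ?_
    refine LogLaplacian.ae_eq_zero_of_orthogonal hN hΩ_open hΩ_bdd hne hmin0 hξ0pos ?_
      (hON.2 one_ne_zero)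
    rw [h]
    exact hweak 1
  · refine ⟨ξ k, ⟨(ξ k).2, fun i hi => ?_⟩, ?_, hval k⟩
    · rw [LogLaplacian.setIntegral_mul_eq (ξ k).2.2.1, ← hinner]
      exact hON.2 hi.ne'
    · exact (LogLaplacian.norm_toL2_eq_one_iff hN hΩm hΩ_bdd _).1 (hON.1 k)
  · rintro _ ⟨u, ⟨huΩ, huorth⟩, hu1, rfl⟩
    have h1 := hmin k ⟨u, huΩ⟩ fun i hi => by
      rw [hinner, ← LogLaplacian.setIntegral_mul_eq huΩ.2.1]
      exact huorth i hi
    rw [(LogLaplacian.norm_toL2_eq_one_iff hN hΩm hΩ_bdd ⟨u, huΩ⟩).2 hu1] at h1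
    simpa using h1
  · refine ⟨HilbertBasis.mk hON hspan, fun k => ?_⟩
    rw [HilbertBasis.coe_mk]
    exact LogLaplacian.coeFn_toL2 hN hΩm hΩ_bdd (ξ k)
  · -- subtracting the component along `ξ 0` leaves a solution orthogonal to `ξ 0`
    intro u hu
    set U : LogLaplacian.hSub Ω := ⟨u, hu.1⟩
    set t : ℝ := inner ℝ (LogLaplacian.toL2 hN hΩm hΩ_bdd U)
      (LogLaplacian.toL2 hN hΩm hΩ_bdd (ξ 0)) with ht
    have hz := (show LogLaplacian.IsWeakSolution Ω (lam 0) (U : LogLaplacian.Space N → ℝ) from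
      hu).add hN hΩ_bdd hΩm ((hweak 0).smul hN hΩ_bdd hΩm (-t))
    have h0 := LogLaplacian.ae_eq_zero_of_orthogonal hN hΩ_open hΩ_bdd hne hmin0 hξ0pos hz (by
      rw [map_add, map_smul, inner_add_left, real_inner_smul_left, real_inner_self_eq_norm_sq,
        hON.1 0, ← ht]
      ring)
    refine ⟨t, ?_⟩
    filter_upwards [h0] with x hx
    have h1 : u x + -t * (ξ 0 : LogLaplacian.Space N → ℝ) x = 0 := hx
    linarith
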